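/- A dynamical system on $\mathbb R^k$ is a $C^\infty$ flow $\Phi\colon\mathbb R\times\mathbb R^k\to\mathbb R^k$; its equilibria are the points fixed by all $\Phi^t$. A linearizing embedding of $\Phi$ is a smooth embedding $f\colon\mathbb R^k\to\mathbb R^n$ (a $C^\infty$ map that is a homeomorphism onto its image and has injective derivatives) such that $\exp(tA)\circ f=f\circ\Phi^t$ for all $t\in\mathbb R$, for some real $n\times n$ matrix $A$; it is then said to be into the linear flow of $A$. (1) For every $k\ge 2$ and every $\ell\in\{0,1,2,\dots\}\cup\{\infty\}$ ($\infty$ meaning countably infinite) there is a dynamical system on $\mathbb R^k$ that has exactly $\ell$ equilibria, all of them isolated, and that admits a linearizing embedding into a linear flow on some $\mathbb R^n$. (2) Consider the linear flow on $\mathbb R^3$ of $\dot x=y,\ \dot y=x,\ \dot z=0$. Let $Q_{\pm1}=\{(x,y,z):|y|<\pm x\}$ be the sets of points whose $(x,y)$ lies in the open quadrant, bounded by the lines $y=\pm x$, that contains $(\pm1,0)$. Let $2\le\ell\le\infty$ and $I_\ell=[0,\ell-1]$ (so $I_\infty=[0,\infty)$). Call a smooth curve $\gamma=(x,y,z)\colon\mathbb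 R\to\mathbb R^3$ an $\ell$-snake if on $I_\ell$ it has $\dot\gamma\neq0$ and $y=0$; if $\gamma(j)=(0,0,j)$ and $z^{(n)}(j)=0$ for all $n\ge1$ and all integers $0\le j<\ell$; and if $(-1)^{j+1}x>0$ and $\dot z>0$ on $(j,j+1)$ for all integers $j\ge0$ with $j+1<\ell$. For integers $0\le j<\ell$ let $A_j^\ell$ be the plane $z=j$ with $Q_{(-1)^j}$ removed if $j\ge1$, and with $Q_{(-1)^{j+1}}$ removed if $j+1<\ell$. Let $B$ be the union of the orbits of the linear flow that meet $\gamma(I_\ell)$, and let $$\Sigma^\ell=\bigcup_{0\le j<\ell}A_j^\ell\ \cup\ B .$$ In particular $\Sigma^2=A_1\cup B\cup A_0$, where $A_0,A_1$ are the planes $z=0$ and $z=1$ with the quadrant containing $(x,y)=(-1,0)$ removed, and $B$ is the union of the orbits that meet $\gamma([0,1])$. For every $\ell$ with $2\le\ell\le\infty$, $\ell$-snakes exist, and for each of them the surface $\Sigma^\ell$ is invariant under the linear flow and is the image of a linearizing embedding $f\colon\mathbb R^2\to\mathbb R^3$, into this linear flow, of a dynamical system on $\mathbb R^2$ that has exactly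 $\ell$ equilibria, all of them isolated. (3) Let $\Phi$ be a dynamical system on $\mathbb R^2$ with exactly $\ell\in\{0,1,2,\dots\}\cup\{\infty\}$ equilibria, all of them isolated, and let $f\colon\mathbb R^2\to\mathbb R^n$ be a linearizing embedding of $\Phi$ into the linear flow of $A$. Then for every $m\ge0$ the flow $(x,w)\mapsto(\Phi^t(x),e^tw)$ on $\mathbb R^2\times\mathbb R^m$, obtained by adding $\dot w=w$, is a dynamical system with exactly $\ell$ equilibria, all of them isolated, and $(x,w)\mapsto(f(x),w)$ is a linearizing embedding of it into the linear flow of $\begin{pmatrix}A&0\\0&I\end{pmatrix}$. -/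

import Mathlib

open scoped ContDiff Topology

/-- The Euclidean space with coordinates indexed by `ι`; `Eucl (Fin k)` is `ℝ^k`, and
`Eucl (Fin k ⊕ Fin m)` is `ℝ^k × ℝ^m`. -/
abbrev Eucl (ι : Type) : Type := EuclideanSpace ℝ ι

/-- A (globally defined) flow `ℝ × ℝ^ι → ℝ^ι` is smooth if it is jointly `C^∞` in time and space. -/
def IsSmoothFlow {ι : Type} [Fintype ι] (Φ : Flow ℝ (Eucl ι)) : Prop :=
  ContDiff ℝ ∞ (fun p : ℝ × Eucl ι => Φ p.1 p.2)

/-- The equilibria of a flow: the points fixed for all times. -/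
def equilibria {ι : Type} [Fintype ι] (Φ : Flow ℝ (Eucl ι)) : Set (Eucl ι) :=
  {x | ∀ t : ℝ, Φ t x = x}

/-- The flow has exactly `ℓ` equilibria (`ℓ = ⊤`: countably infinitely many), and each of them is
isolated in the set of all equilibria. -/
structure HasIsolatedEquilibria {ι : Type} [Fintype ι] (Φ : Flow ℝ (Eucl ι)) (ℓ : ℕ∞) : Prop where
  countable : (equilibria Φ).Countable
  encard_eq : (equilibria Φ).encard = ℓ
  isolated : ∀ x ∈ equilibria Φ, ∃ U ∈ 𝓝 x, U ∩ equilibria Φ = {x}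

/-- The time-`t` map `v ↦ exp (t A) v` of the linear system `v' = A v`. -/
noncomputable def linearFlow {κ : Type} [Fintype κ] [DecidableEq κ] (A : Matrix κ κ ℝ)
    (t : ℝ) (v : Eucl κ) : Eucl κ :=
  WithLp.toLp 2 ((NormedSpace.exp (t • A)).mulVec v.ofLp)

/-- `f` is a linearizing embedding of the flow `Φ` into the linear flow generated by `A`: a smooth
embedding (homeomorphism onto the image with injective derivatives) that is equivariant. -/
structure IsLinearizingEmbedding {ι κ : Type} [Fintype ι] [Fintype κ] [DecidableEq κ]
    (Φ : Flow ℝ (Eucl ι)) (A : Matrix κ κ ℝ) (f : Eucl ι → Eucl κ) : Prop where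
  smooth : ContDiff ℝ ∞ f
  isEmbedding : Topology.IsEmbedding f
  immersion : ∀ x, Function.Injective (fderiv ℝ f x)
  equivariant : ∀ (t : ℝ) (x : Eucl ι), linearFlow A t (f x) = f (Φ t x)

/-- The flow embeds equivariantly into a linear flow on some `ℝ^n`. -/
def AdmitsLinearizingEmbedding {ι : Type} [Fintype ι] (Φ : Flow ℝ (Eucl ι)) : Prop :=
  ∃ (n : ℕ) (A : Matrix (Fin n) (Fin n) ℝ) (f : Eucl ι → Eucl (Fin n)),
    IsLinearizingEmbedding Φ A f

/-! ### The surfaces in `ℝ³`; the coordinates `x, y, z` are the coordinates `0, 1, 2` -/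

/-- The matrix of the linear system `x' = y, y' = x, z' = 0`. -/
def hyperbolicMatrix : Matrix (Fin 3) (Fin 3) ℝ :=
  !![0, 1, 0; 1, 0, 0; 0, 0, 0]

/-- For `σ = 1` or `σ = -1`: the points whose `(x, y)` lies in the open quadrant, among the four
into which the lines `y = x` and `y = -x` divide the plane, that contains `(σ, 0)`. -/
def quadrant (σ : ℝ) : Set (Eucl (Fin 3)) :=
  {p | |p 1| < σ * p 0}

/-- The plane `z = h` with the quadrants containing `(σ, 0)`, `σ ∈ S`, removed. -/
def cutPlane (h : ℝ) (S : Set ℝ) : Set (Eucl (Fin 3)) :=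
  {p | p 2 = h} \ ⋃ σ ∈ S, quadrant σ

/-- The union of the orbits of the system `x' = y, y' = x, z' = 0` that meet `C`. -/
def orbitsThrough (C : Set (Eucl (Fin 3))) : Set (Eucl (Fin 3)) :=
  {p | ∃ q ∈ C, ∃ t : ℝ, p = linearFlow hyperbolicMatrix t q}

/-- The parameter interval `[0, ℓ - 1]` (which is `[0, ∞)` if `ℓ = ⊤`). -/
def paramSet (ℓ : ℕ∞) : Set ℝ :=
  {s | 0 ≤ s ∧ ∃ j : ℕ, (j : ℕ∞) < ℓ ∧ s ≤ j}

/-- The arc traced out by `γ` over `[0, ℓ - 1]`. -/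
def arc (ℓ : ℕ∞) (γ : ℝ → Eucl (Fin 3)) : Set (Eucl (Fin 3)) :=
  γ '' paramSet ℓ

/-- A smooth regular curve in the plane `y = 0` that snakes upwards through the `ℓ` points
`(0, 0, j)`, `j < ℓ`, reached at the times `j`. Between the times `j` and `j + 1` it rises in `z` and
runs in the half-plane `x < 0` if `j` is even and in `x > 0` if `j` is odd. At the time `j` it is
tangent to infinite order to the line `z = j`, as is needed to continue the plane `z = j` smoothly. -/
structure IsSnake (ℓ : ℕ∞) (γ : ℝ → Eucl (Fin 3)) : Prop where
  smooth : ContDiff ℝ ∞ γ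
  regular : ∀ s ∈ paramSet ℓ, deriv γ s ≠ 0
  planar : ∀ s ∈ paramSet ℓ, γ s 1 = 0
  joint : ∀ j : ℕ, (j : ℕ∞) < ℓ → γ j 0 = 0 ∧ γ j 2 = j
  flat : ∀ j : ℕ, (j : ℕ∞) < ℓ → ∀ n : ℕ, 1 ≤ n → iteratedDeriv n (fun s => γ s 2) j = 0
  side : ∀ j : ℕ, ((j + 1 : ℕ) : ℕ∞) < ℓ → ∀ s ∈ Set.Ioo (j : ℝ) (j + 1),
    0 < (-1 : ℝ) ^ (j + 1) * γ s 0
  rising : ∀ j : ℕ, ((j + 1 : ℕ) : ℕ∞) < ℓ → ∀ s ∈ Set.Ioo (j : ℝ) (j + 1),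
    0 < deriv (fun s => γ s 2) s

/-- The quadrants that are removed from the `j`-th of `ℓ` planes: the one on the side of the arc
arriving from the plane below, and the one on the side of the arc leaving to the plane above. -/
def removedSides (ℓ : ℕ∞) (j : ℕ) : Set ℝ :=
  {σ | (1 ≤ j ∧ σ = (-1) ^ j) ∨ (((j + 1 : ℕ) : ℕ∞) < ℓ ∧ σ = (-1) ^ (j + 1))}

/-- The surface made of `ℓ` cut planes at the heights `0, 1, 2, …` and of the orbits through the
arc that joins their equilibria. -/
def stackedSurface (ℓ : ℕ∞) (γ : ℝ → Eucl (Fin 3)) : Set (Eucl (Fin 3)) :=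
  (⋃ j ∈ {j : ℕ | (j : ℕ∞) < ℓ}, cutPlane j (removedSides ℓ j)) ∪ orbitsThrough (arc ℓ γ)

/-! ### Adding the coordinates `w' = w` -/

/-- The map `(x, w) ↦ (f x, w)`. -/
def expandMap {ι κ : Type} (m : ℕ) (f : Eucl ι → Eucl κ) (p : Eucl (ι ⊕ Fin m)) :
    Eucl (κ ⊕ Fin m) :=
  WithLp.toLp 2 (Sum.elim (f (WithLp.toLp 2 fun i => p (Sum.inl i))) fun i => p (Sum.inr i))

/-- The flow `(x, w) ↦ (Φ^t x, e^t w)` of the system in which `w' = w` is added to `Φ`. -/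
noncomputable def expandFlow {ι : Type} [Fintype ι] (m : ℕ) (Φ : Flow ℝ (Eucl ι)) :
    Flow ℝ (Eucl (ι ⊕ Fin m)) where
  toFun t p := WithLp.toLp 2
    (Sum.elim (Φ t (WithLp.toLp 2 fun i => p (Sum.inl i))) fun i => Real.exp t * p (Sum.inr i))
  cont' := by
    have h : Continuous fun q : ℝ × Eucl (ι ⊕ Fin m) =>
        Φ q.1 (WithLp.toLp 2 fun i => q.2 (Sum.inl i)) :=
      Φ.continuous continuous_fst (by fun_prop)
    refine (PiLp.continuous_toLp 2 _).comp (continuous_pi ?_)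
    rintro (i | i)
    · exact (PiLp.continuous_apply 2 _ i).comp h
    · simp only [Sum.elim_inr]
      fun_prop
  map_add' s t p := by
    ext (i | i)
    · simp [Φ.map_add]
    · simp [Real.exp_add, mul_assoc]
  map_zero' p := by
    ext (i | i) <;> simp

/-!
An orbit of `x' = y, y' = x` in the open quadrants around the `x`-axis meets that axis exactly once,
at the signed abscissa `hypRadius x y = ±√(x² - y²)`, which vanishes on the rest of the plane. For a
curve `s ↦ (x s, 0, z s)` the union of its orbits and of the planes with pieces cut out is therefore
the set of points `(v, y, z s)` with `hypRadius v y = x s`. Although `hypRadius` is not smooth,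
its composition with a function all of whose derivatives vanish at `0` is, since these derivatives
absorb the powers of `1 / hypRadius`.
-/

/-! ### Functions that are flat at a point -/

/-- A smooth function on `ℝ` all of whose derivatives of positive order vanish at `c`. Its value at
`c` is arbitrary. -/
structure IsFlatAt (f : ℝ → ℝ) (c : ℝ) : Prop where
  contDiff : ContDiff ℝ ∞ f
  iteratedDeriv_eq_zero : ∀ n, 1 ≤ n → iteratedDeriv n f c = 0

theorem isFlatAt_const (a c : ℝ) : IsFlatAt (fun _ => a) c where
  contDiff := contDiff_const
  iteratedDeriv_eq_zero n hn := by simp [iteratedDeriv_const, Nat.one_le_iff_ne_zero.1 hn]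

namespace IsFlatAt

variable {f g : ℝ → ℝ} {a c : ℝ}

theorem hasDerivAt (hf : IsFlatAt f c) (s : ℝ) : HasDerivAt f (deriv f s) s :=
  (hf.contDiff.differentiable (by simp) s).hasDerivAt

theorem deriv_eq_zero (hf : IsFlatAt f c) : deriv f c = 0 := by
  simpa using hf.iteratedDeriv_eq_zero 1 le_rfl

protected theorem deriv (hf : IsFlatAt f c) : IsFlatAt (deriv f) c where
  contDiff := (contDiff_infty_iff_deriv.1 hf.contDiff).2
  iteratedDeriv_eq_zero n _ := by
    rw [← iteratedDeriv_succ']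
    exact hf.iteratedDeriv_eq_zero _ (by lia)

theorem sub_const (hf : IsFlatAt f c) (a : ℝ) : IsFlatAt (fun s => f s - a) c where
  contDiff := hf.contDiff.sub contDiff_const
  iteratedDeriv_eq_zero n hn := by
    obtain ⟨n, rfl⟩ := Nat.exists_eq_add_of_le' hn
    rw [iteratedDeriv_succ', show deriv (fun s => f s - a) = deriv f by ext; simp,
      ← iteratedDeriv_succ']
    exact hf.iteratedDeriv_eq_zero _ hn

theorem div_const (hf : IsFlatAt f c) (a : ℝ) : IsFlatAt (fun s => f s / a) c where
  contDiff := hf.contDiff.div_const a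
  iteratedDeriv_eq_zero n hn := by
    simp [div_eq_inv_mul, iteratedDeriv_const_mul_field, hf.iteratedDeriv_eq_zero n hn]

theorem of_hasDerivAt {F : ℝ → ℝ} (hf : IsFlatAt f c) (hzero : f c = 0)
    (hF : ∀ s, HasDerivAt F (f s) s) : IsFlatAt F c := by
  have hderiv : deriv F = f := funext fun s => (hF s).deriv
  refine ⟨contDiff_infty_iff_deriv.2 ⟨fun s => (hF s).differentiableAt, hderiv ▸ hf.contDiff⟩,
    fun n hn => ?_⟩
  obtain ⟨n, rfl⟩ := Nat.exists_eq_add_of_le' hn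
  rw [iteratedDeriv_succ', hderiv]
  rcases n.eq_zero_or_pos with rfl | hpos
  · rw [iteratedDeriv_zero, hzero]
  · exact hf.iteratedDeriv_eq_zero n hpos

theorem congr_of_eventuallyEq (hf : IsFlatAt f c) (hg : ContDiff ℝ ∞ g) (hfg : g =ᶠ[𝓝 c] f) :
    IsFlatAt g c where
  contDiff := hg
  iteratedDeriv_eq_zero n hn := (hfg.iteratedDeriv_eq n).trans (hf.iteratedDeriv_eq_zero n hn)

theorem comp (hf : IsFlatAt f (g c)) (hg : ContDiff ℝ ∞ g) : IsFlatAt (fun s => f (g s)) c where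
  contDiff := hf.contDiff.comp hg
  iteratedDeriv_eq_zero n hn := by
    have hf₀ := hf.sub_const (f (g c))
    have hzero (i : ℕ) : ‖iteratedFDeriv ℝ i (fun u => f u - f (g c)) (g c)‖ ≤ 0 := by
      rw [norm_iteratedFDeriv_eq_norm_iteratedDeriv]
      rcases Nat.eq_zero_or_pos i with rfl | hi
      · simp
      · simp [hf₀.iteratedDeriv_eq_zero i hi]
    have hbound (i : ℕ) (hi : 1 ≤ i) (hin : i ≤ n) : ‖iteratedFDeriv ℝ i g c‖ ≤
        (1 + ∑ j ∈ Finset.range (n + 1), ‖iteratedFDeriv ℝ j g c‖) ^ i := by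
      have hsum := Finset.single_le_sum (f := fun j => ‖iteratedFDeriv ℝ j g c‖)
        (fun j _ => norm_nonneg _) (Finset.mem_range.2 (Nat.lt_succ_of_le hin))
      exact (hsum.trans (by linarith)).trans (le_self_pow₀
        (le_add_of_nonneg_right (Finset.sum_nonneg fun j _ => norm_nonneg _)) (by lia))
    have hcomp := norm_iteratedFDeriv_comp_le (n := n) hf₀.contDiff hg (by exact_mod_cast le_top) c
      (fun i _ => hzero i) hbound
    rw [norm_iteratedFDeriv_eq_norm_iteratedDeriv, mul_zero, zero_mul, norm_le_zero_iff] at hcomp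
    have hcongr : iteratedDeriv n (fun s => f (g s) - f (g c)) c =
        iteratedDeriv n (fun s => f (g s)) c := by
      obtain ⟨n, rfl⟩ := Nat.exists_eq_add_of_le' hn
      rw [iteratedDeriv_succ', iteratedDeriv_succ']
      congr 1
      ext
      simp
    exact hcongr ▸ hcomp

theorem of_eqOn_Iic (hf : ContDiff ℝ ∞ f) (hconst : Set.EqOn f (fun _ => a) (Set.Iic c)) :
    IsFlatAt f c where
  contDiff := hf
  iteratedDeriv_eq_zero n hn := by
    have hcont : Continuous (iteratedDeriv n f) :=
      hf.continuous_iteratedDeriv n (by exact_mod_cast le_top)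
    have hleft : Set.EqOn (iteratedDeriv n f) 0 (Set.Iio c) := fun s hs => by
      have heq : f =ᶠ[𝓝 s] fun _ => a := by
        filter_upwards [Iio_mem_nhds hs] with u hu using hconst (Set.mem_Iio.1 hu).le
      rw [heq.iteratedDeriv_eq n, iteratedDeriv_const, if_neg (by lia), Pi.zero_apply]
    exact hleft.closure hcont continuous_const (by simp)

theorem isLittleO_pow (hf : IsFlatAt f c) (n : ℕ) :
    (fun s => f s - f c) =o[𝓝 c] fun s => (s - c) ^ n := by
  have htaylor (s : ℝ) : taylorWithinEval f n Set.univ c s = f c := by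
    induction n with
    | zero => exact taylor_within_zero_eval f _ _ _
    | succ n ih =>
      rw [taylorWithinEval_succ, iteratedDerivWithin_univ, hf.iteratedDeriv_eq_zero _ (by lia),
        smul_zero, add_zero, ih]
  have hsmooth : ContDiff ℝ n f := hf.contDiff.of_le (by exact_mod_cast le_top)
  exact (taylor_isLittleO_univ hsmooth).congr_left fun s => by rw [htaylor s]

end IsFlatAt

theorem contDiff_of_hasFDerivAt_family {E F α : Type*} [NormedAddCommGroup E] [NormedSpace ℝ E]
    [NormedAddCommGroup F] [NormedSpace ℝ F] {f : α → E → F} {f' : α → E → E →L[ℝ] F}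
    (hderiv : ∀ a x, HasFDerivAt (f a) (f' a x) x)
    (hsmooth : ∀ n : ℕ, (∀ a, ContDiff ℝ n (f a)) → ∀ a, ContDiff ℝ n (f' a)) (a : α) :
    ContDiff ℝ ∞ (f a) := by
  rw [contDiff_infty]
  intro n
  induction n generalizing a with
  | zero =>
    exact contDiff_zero.2 (continuous_iff_continuousAt.2 fun x => (hderiv a x).continuousAt)
  | succ n ih => exact contDiff_succ_iff_hasFDerivAt.2 ⟨f' a, hsmooth n ih a, hderiv a⟩

section Clamp

variable {f : ℝ → ℝ} {c : ℝ}

theorem IsFlatAt.hasDerivAt_comp_max (hf : IsFlatAt f c) (s : ℝ) :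
    HasDerivAt (fun s => f (max s c)) (deriv f (max s c)) s := by
  rcases lt_trichotomy s c with hs | rfl | hs
  · have heq : (fun s => f (max s c)) =ᶠ[𝓝 s] fun _ => f c := by
      filter_upwards [Iio_mem_nhds hs] with u hu
      rw [max_eq_right (le_of_lt hu)]
    rw [max_eq_right hs.le, hf.deriv_eq_zero]
    exact (hasDerivAt_const s (f c)).congr_of_eventuallyEq heq
  · rw [max_self, hf.deriv_eq_zero, hasDerivAt_iff_isLittleO]
    have htendsto : Filter.Tendsto (fun u => max u s) (𝓝 s) (𝓝 s) :=
      (Continuous.tendsto' (by fun_prop) s s (max_self s))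
    have hclamp : (fun u => max u s - s) =O[𝓝 s] fun u => u - s :=
      .of_bound' (.of_forall fun u => by
        simpa using abs_max_sub_max_le_abs u s s)
    simpa [Function.comp_def] using ((hf.isLittleO_pow 1).comp_tendsto htendsto).trans_isBigO
      (by simpa [Function.comp_def] using hclamp)
  · have heq : (fun s => f (max s c)) =ᶠ[𝓝 s] f := by
      filter_upwards [Ioi_mem_nhds hs] with u hu
      rw [max_eq_left (le_of_lt hu)]
    rw [max_eq_left hs.le]
    exact (hf.hasDerivAt s).congr_of_eventuallyEq heq

theorem IsFlatAt.contDiff_comp_max (hf : IsFlatAt f c) : ContDiff ℝ ∞ fun s => f (max s c) :=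
  contDiff_of_hasFDerivAt_family (α := {f : ℝ → ℝ // IsFlatAt f c})
    (f := fun f s => f.1 (max s c))
    (fun f s => (f.2.hasDerivAt_comp_max s).hasFDerivAt)
    (fun _ ih f =>
      (ContinuousLinearMap.toSpanSingletonCLE (𝕜 := ℝ) (E := ℝ)).contDiff.comp (ih ⟨_, f.2.deriv⟩))
    ⟨f, hf⟩

theorem IsFlatAt.comp_max (hc : IsFlatAt f c) {d : ℝ} (hd : IsFlatAt f d) (hcd : c ≤ d) :
    IsFlatAt (fun s => f (max s c)) d := by
  rcases hcd.eq_or_lt with rfl | hlt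
  · exact .of_eqOn_Iic (a := f c) hc.contDiff_comp_max fun s hs => by
      simp [max_eq_right (Set.mem_Iic.1 hs)]
  · refine hd.congr_of_eventuallyEq hc.contDiff_comp_max ?_
    filter_upwards [Ioi_mem_nhds hlt] with s hs
    rw [max_eq_left (Set.mem_Ioi.1 hs).le]

theorem IsFlatAt.comp_neg (hf : IsFlatAt f (-c)) : IsFlatAt (fun s => f (-s)) c :=
  hf.comp contDiff_neg

theorem IsFlatAt.comp_min (hc : IsFlatAt f c) {d : ℝ} (hd : IsFlatAt f d) (hdc : d ≤ c) :
    IsFlatAt (fun s => f (min s c)) d := by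
  have hneg : IsFlatAt (fun s => f (-s)) (-c) := .comp_neg (by simpa using hc)
  have hneg' : IsFlatAt (fun s => f (-s)) (-d) := .comp_neg (by simpa using hd)
  simpa [max_neg_neg] using (hneg.comp_max hneg' (neg_le_neg hdc)).comp_neg

end Clamp

/-! ### Coordinates adapted to the orbits of `x' = y, y' = x` -/

/-- The signed abscissa at which the orbit of `(v, y)` under `x' = y, y' = x` meets the `x`-axis.
Where there is no such point, that is for `|v| ≤ |y|`, it is `0`, as `√` vanishes on negative
numbers. -/
noncomputable def hypRadius (v y : ℝ) : ℝ := Real.sign v * √(v ^ 2 - y ^ 2)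

/-- The abscissa of the point at height `w` on the orbit of `(u, 0)` under `x' = y, y' = x`. -/
noncomputable def hypAbscissa (u w : ℝ) : ℝ := Real.sign u * √(u ^ 2 + w ^ 2)

section HypRadius

variable {u v w y : ℝ}

theorem abs_sign_of_ne_zero (hv : v ≠ 0) : |Real.sign v| = 1 := by
  rcases Real.sign_apply_eq_of_ne_zero v hv with h | h <;> simp [h]

theorem sign_eventuallyEq (hv : v ≠ 0) : Real.sign =ᶠ[𝓝 v] fun _ => Real.sign v := by
  rcases lt_or_gt_of_ne hv with hv | hv
  · filter_upwards [Iio_mem_nhds hv] with u hu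
    rw [Real.sign_of_neg hv, Real.sign_of_neg hu]
  · filter_upwards [Ioi_mem_nhds hv] with u hu
    rw [Real.sign_of_pos hv, Real.sign_of_pos hu]

theorem hypRadius_of_abs_le (h : |v| ≤ |y|) : hypRadius v y = 0 := by
  rw [hypRadius, Real.sqrt_eq_zero_of_nonpos (sub_nonpos.2 (sq_le_sq.2 h)), mul_zero]

theorem hypRadius_neg (v y : ℝ) : hypRadius (-v) y = -hypRadius v y := by
  rw [hypRadius, hypRadius, Real.sign_neg, neg_sq, neg_mul]

theorem hypRadius_pos_iff : 0 < hypRadius v y ↔ |y| < v := by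
  rcases le_or_gt v 0 with hv | hv
  · have hsign : Real.sign v ≤ 0 := by
      rcases hv.lt_or_eq with hv | rfl
      · simp [Real.sign_of_neg hv]
      · simp
    exact iff_of_false (mul_nonpos_of_nonpos_of_nonneg hsign (Real.sqrt_nonneg _)).not_gt
      (hv.trans (abs_nonneg y)).not_gt
  · rw [hypRadius, Real.sign_of_pos hv, one_mul, Real.sqrt_pos, sub_pos, sq_lt_sq, abs_of_pos hv]

theorem hypRadius_neg_iff : hypRadius v y < 0 ↔ |y| < -v := by
  rw [← hypRadius_pos_iff, hypRadius_neg, neg_pos]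

theorem hypRadius_eq_zero_iff : hypRadius v y = 0 ↔ |v| ≤ |y| := by
  refine ⟨fun h => abs_le'.2 ⟨?_, ?_⟩, hypRadius_of_abs_le⟩
  · exact not_lt.1 fun hlt => (hypRadius_pos_iff.2 hlt).ne' h
  · exact not_lt.1 fun hlt => (hypRadius_neg_iff.2 hlt).ne h

theorem sq_hypRadius (h : |y| ≤ |v|) : hypRadius v y ^ 2 = v ^ 2 - y ^ 2 := by
  rcases eq_or_ne v 0 with rfl | hv
  · obtain rfl : y = 0 := by simpa using h
    simp [hypRadius]
  · rw [hypRadius, mul_pow, Real.sq_sqrt (sub_nonneg.2 (sq_le_sq.2 h)), ← sq_abs,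
      abs_sign_of_ne_zero hv, one_pow, one_mul]

theorem abs_hypRadius_le (v y : ℝ) : |hypRadius v y| ≤ |v| := by
  rcases le_total |v| |y| with h | h
  · rw [hypRadius_of_abs_le h, abs_zero]
    exact abs_nonneg v
  · rw [← sq_le_sq, sq_hypRadius h]
    linarith [sq_nonneg y]

theorem hypAbscissa_zero_right (u : ℝ) : hypAbscissa u 0 = u := by
  rcases lt_trichotomy u 0 with hu | rfl | hu
  · simp [hypAbscissa, Real.sign_of_neg hu, Real.sqrt_sq_eq_abs, abs_of_neg hu]
  · simp [hypAbscissa]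
  · simp [hypAbscissa, Real.sign_of_pos hu, Real.sqrt_sq_eq_abs, abs_of_pos hu]

theorem hypRadius_zero_right (v : ℝ) : hypRadius v 0 = v := by
  simpa [hypRadius, hypAbscissa] using hypAbscissa_zero_right v

theorem hypAbscissa_neg (u w : ℝ) : hypAbscissa (-u) w = -hypAbscissa u w := by
  rw [hypAbscissa, hypAbscissa, Real.sign_neg, neg_sq, neg_mul]

theorem le_hypAbscissa_iff (hu : 0 < u) : v ≤ hypAbscissa u y ↔ hypRadius v y ≤ u := by
  rw [hypAbscissa, Real.sign_of_pos hu, one_mul]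
  rcases le_or_gt v |y| with hv | hv
  · refine iff_of_true (hv.trans (Real.abs_le_sqrt (by linarith [sq_nonneg u]))) ?_
    exact (not_lt.1 (mt hypRadius_pos_iff.1 hv.not_gt)).trans hu.le
  · have hv₀ : 0 < v := (abs_nonneg y).trans_lt hv
    rw [hypRadius, Real.sign_of_pos hv₀, one_mul, Real.le_sqrt hv₀.le, Real.sqrt_le_left hu.le,
      sub_le_iff_le_add]
    positivity

theorem sq_hypAbscissa (hu : u ≠ 0) (w : ℝ) : hypAbscissa u w ^ 2 = u ^ 2 + w ^ 2 := by
  rw [hypAbscissa, mul_pow, Real.sq_sqrt (by positivity), ← sq_abs, abs_sign_of_ne_zero hu,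
    one_pow, one_mul]

theorem sign_hypAbscissa (u w : ℝ) : Real.sign (hypAbscissa u w) = Real.sign u := by
  rcases lt_trichotomy u 0 with hu | rfl | hu
  · rw [hypAbscissa, Real.sign_of_neg hu, Real.sign_of_neg]
    have : 0 < √(u ^ 2 + w ^ 2) := Real.sqrt_pos.2 (by nlinarith)
    linarith
  · simp [hypAbscissa]
  · rw [hypAbscissa, Real.sign_of_pos hu, one_mul,
      Real.sign_of_pos (Real.sqrt_pos.2 (by positivity))]

theorem hypRadius_hypAbscissa (hu : u ≠ 0) (w : ℝ) : hypRadius (hypAbscissa u w) w = u := by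
  rw [hypRadius, sq_hypAbscissa hu, sign_hypAbscissa, add_sub_cancel_right]
  simpa [hypAbscissa] using hypAbscissa_zero_right u

theorem sign_hypRadius (h : hypRadius v y ≠ 0) : Real.sign (hypRadius v y) = Real.sign v := by
  rcases lt_or_gt_of_ne h with hneg | hpos
  · have hv := (abs_nonneg y).trans_lt (hypRadius_neg_iff.1 hneg)
    rw [Real.sign_of_neg hneg, Real.sign_of_neg (neg_pos.1 hv)]
  · have hv := (abs_nonneg y).trans_lt (hypRadius_pos_iff.1 hpos)
    rw [Real.sign_of_pos hpos, Real.sign_of_pos hv]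

theorem hypAbscissa_hypRadius (h : hypRadius v y ≠ 0) : hypAbscissa (hypRadius v y) y = v := by
  have hle : |y| ≤ |v| := (not_le.1 (mt hypRadius_of_abs_le h)).le
  rw [hypAbscissa, sign_hypRadius h, sq_hypRadius hle, sub_add_cancel]
  simpa [hypAbscissa] using hypAbscissa_zero_right v

theorem mem_uIcc_hypAbscissa (u w : ℝ) : u ∈ Set.uIcc 0 (hypAbscissa u w) := by
  wlog hu : 0 < u generalizing u
  · rcases (not_lt.1 hu).eq_or_lt with rfl | hneg
    · exact Set.left_mem_uIcc
    · have h := this (-u) (neg_pos.2 hneg)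
      rw [hypAbscissa_neg] at h
      simpa [Set.mem_uIcc, neg_le, le_neg, and_comm, or_comm] using h
  rw [Set.mem_uIcc]
  exact .inl ⟨hu.le, (le_hypAbscissa_iff hu).2 ((le_abs_self _).trans
    ((abs_hypRadius_le u w).trans_eq (abs_of_pos hu)))⟩

theorem hypRadius_hypAbscissa_mem_uIcc (u : ℝ) {w y : ℝ} (h : |w| ≤ |y|) :
    hypRadius (hypAbscissa u w) y ∈ Set.uIcc 0 u := by
  wlog hu : 0 < u generalizing u
  · rcases (not_lt.1 hu).eq_or_lt with rfl | hneg
    · simp [hypAbscissa, hypRadius]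
    · have h := this (-u) (neg_pos.2 hneg)
      rw [hypAbscissa_neg, hypRadius_neg] at h
      simpa [Set.mem_uIcc, neg_le, le_neg, and_comm, or_comm] using h
  have hpos : 0 ≤ hypAbscissa u w := by
    simp [hypAbscissa, Real.sign_of_pos hu]
  have hle : hypAbscissa u w ≤ hypAbscissa u y := by
    simp only [hypAbscissa, Real.sign_of_pos hu, one_mul]
    exact Real.sqrt_le_sqrt (by gcongr u ^ 2 + ?_; exact sq_le_sq.2 h)
  refine Set.mem_uIcc.2 (.inl ⟨not_lt.1 fun hneg => ?_, (le_hypAbscissa_iff hu).1 hle⟩)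
  linarith [hypRadius_neg_iff.1 hneg, abs_nonneg y]

theorem hypAbscissa_eq_mul_sqrt (hu : u ≠ 0) (w : ℝ) :
    hypAbscissa u w = u * √(1 + (w / u) ^ 2) := by
  have hsq : u ^ 2 + w ^ 2 = (u ^ 2 + 0 ^ 2) * (1 + (w / u) ^ 2) := by
    field_simp
    ring
  rw [hypAbscissa, hsq, Real.sqrt_mul (by positivity), ← mul_assoc, ← hypAbscissa,
    hypAbscissa_zero_right]

theorem contDiffAt_hypAbscissa {n : WithTop ℕ∞} {p : ℝ × ℝ} (hp : p.1 ≠ 0) :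
    ContDiffAt ℝ n (fun p : ℝ × ℝ => hypAbscissa p.1 p.2) p := by
  have hsqrt : ContDiffAt ℝ n (fun q : ℝ × ℝ => Real.sign p.1 * √(q.1 ^ 2 + q.2 ^ 2)) p :=
    contDiffAt_const.mul (ContDiffAt.sqrt (by fun_prop) (by positivity))
  refine hsqrt.congr_of_eventuallyEq ?_
  filter_upwards [continuous_fst.continuousAt.eventually (sign_eventuallyEq hp)] with q hq
  rw [hypAbscissa, hq]

theorem hasFDerivAt_hypRadius {p : ℝ × ℝ} (hp : |p.2| < |p.1|) :
    HasFDerivAt (fun p : ℝ × ℝ => hypRadius p.1 p.2) ((hypRadius p.1 p.2)⁻¹ •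
      (p.1 • ContinuousLinearMap.fst ℝ ℝ ℝ - p.2 • ContinuousLinearMap.snd ℝ ℝ ℝ)) p := by
  have hv : p.1 ≠ 0 := abs_pos.1 ((abs_nonneg _).trans_lt hp)
  have hpos : 0 < p.1 ^ 2 - p.2 ^ 2 := sub_pos.2 (sq_lt_sq.2 hp)
  have hquad : HasFDerivAt (fun q : ℝ × ℝ => q.1 ^ 2 - q.2 ^ 2)
      ((2 : ℝ) •
        (p.1 • ContinuousLinearMap.fst ℝ ℝ ℝ - p.2 • ContinuousLinearMap.snd ℝ ℝ ℝ)) p := by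
    refine ((hasFDerivAt_fst.pow 2).sub (hasFDerivAt_snd.pow 2)).congr_fderiv ?_
    ext <;> simp
  have hsqrt : HasFDerivAt (fun q : ℝ × ℝ => Real.sign p.1 * √(q.1 ^ 2 - q.2 ^ 2))
      ((hypRadius p.1 p.2)⁻¹ •
        (p.1 • ContinuousLinearMap.fst ℝ ℝ ℝ - p.2 • ContinuousLinearMap.snd ℝ ℝ ℝ)) p := by
    refine ((hquad.sqrt hpos.ne').const_mul _).congr_fderiv ?_
    rw [smul_smul, smul_smul, hypRadius, mul_inv, Real.inv_sign]
    congr 1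
    ring
  refine hsqrt.congr_of_eventuallyEq ?_
  filter_upwards [continuous_fst.continuousAt.eventually (sign_eventuallyEq hv)] with q hq
  rw [hypRadius, hq]

end HypRadius

section FlatComp

variable {φ : ℝ → ℝ}

theorem sq_hypRadius_isBigO {p : ℝ × ℝ} (hp : |p.1| ≤ |p.2|) :
    (fun q : ℝ × ℝ => hypRadius q.1 q.2 ^ 2) =O[𝓝 p] fun q => q - p := by
  have hquad : DifferentiableAt ℝ (fun q : ℝ × ℝ => q.1 ^ 2 - q.2 ^ 2) p := by fun_prop
  refine (Asymptotics.IsBigO.of_bound' (.of_forall fun q => ?_)).trans hquad.isBigO_sub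
  rcases le_total |q.1| |q.2| with hq | hq
  · simp [hypRadius_of_abs_le hq]
  · rw [sq_hypRadius hq, Real.norm_eq_abs, Real.norm_eq_abs,
      abs_of_nonneg (sub_nonneg.2 (sq_le_sq.2 hq))]
    linarith [le_abs_self (q.1 ^ 2 - q.2 ^ 2 - (p.1 ^ 2 - p.2 ^ 2)), sq_le_sq.2 hp]

theorem IsFlatAt.isLittleO_comp_hypRadius_div_pow (hφ : IsFlatAt φ 0) (hzero : φ 0 = 0) (m : ℕ)
    {p : ℝ × ℝ} (hp : |p.1| ≤ |p.2|) :
    (fun q : ℝ × ℝ => φ (hypRadius q.1 q.2) / hypRadius q.1 q.2 ^ m) =o[𝓝 p] fun q => q - p := by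
  have hflat : (fun s => φ s / s ^ m) =o[𝓝 0] fun s => s ^ 2 := by
    have hlittle := (hφ.isLittleO_pow (m + 2)).mul_isBigO
      (Asymptotics.isBigO_refl (fun s : ℝ => (s ^ m)⁻¹) (𝓝 0))
    refine (hlittle.trans_isBigO (.of_bound' (.of_forall fun s => ?_))).congr_left fun s => ?_
    · rcases eq_or_ne s 0 with rfl | hs
      · simp
      · rw [sub_zero, pow_add, mul_right_comm, mul_inv_cancel₀ (pow_ne_zero m hs), one_mul]
    · rw [hzero, sub_zero, div_eq_mul_inv]
  have hradius : Filter.Tendsto (fun q : ℝ × ℝ => hypRadius q.1 q.2) (𝓝 p) (𝓝 0) := by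
    have hsub : Filter.Tendsto (fun q => q - p) (𝓝 p) (𝓝 0) :=
      (continuous_id.sub continuous_const).tendsto' p 0 (sub_self p)
    have hsq := (sq_hypRadius_isBigO hp).trans_tendsto hsub
    refine (tendsto_zero_iff_abs_tendsto_zero _).2 ?_
    simpa [Real.sqrt_sq_eq_abs, Function.comp_def] using hsq.sqrt
  exact (hflat.comp_tendsto hradius).trans_isBigO (sq_hypRadius_isBigO hp)

theorem IsFlatAt.hasFDerivAt_comp_hypRadius_div_pow (hφ : IsFlatAt φ 0) (hzero : φ 0 = 0) (m : ℕ)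
    (p : ℝ × ℝ) :
    HasFDerivAt (fun q : ℝ × ℝ => φ (hypRadius q.1 q.2) / hypRadius q.1 q.2 ^ m)
      ((deriv φ (hypRadius p.1 p.2) / hypRadius p.1 p.2 ^ (m + 1) -
          m * (φ (hypRadius p.1 p.2) / hypRadius p.1 p.2 ^ (m + 2))) •
        (p.1 • ContinuousLinearMap.fst ℝ ℝ ℝ - p.2 • ContinuousLinearMap.snd ℝ ℝ ℝ)) p := by
  rcases le_or_gt |p.1| |p.2| with hp | hp
  · simpa [hasFDerivAt_iff_isLittleO, hypRadius_of_abs_le hp, hzero, hφ.deriv_eq_zero]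
      using hφ.isLittleO_comp_hypRadius_div_pow hzero m hp
  · have hR : hypRadius p.1 p.2 ≠ 0 := mt hypRadius_eq_zero_iff.1 hp.not_ge
    have hdiv : HasDerivAt (fun s => φ s / s ^ m)
        (deriv φ (hypRadius p.1 p.2) / hypRadius p.1 p.2 ^ m -
          m * (φ (hypRadius p.1 p.2) / hypRadius p.1 p.2 ^ (m + 1))) (hypRadius p.1 p.2) := by
      refine ((hφ.hasDerivAt _).div (hasDerivAt_pow m _) (pow_ne_zero m hR)).congr_deriv ?_
      rcases m with _ | m
      · simp
      · rw [Nat.add_sub_cancel]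
        field_simp
        ring
    refine (hdiv.comp_hasFDerivAt p (hasFDerivAt_hypRadius hp)).congr_fderiv ?_
    rw [smul_smul]
    congr 1
    field_simp
    ring

theorem IsFlatAt.contDiff_comp_hypRadius (hφ : IsFlatAt φ 0) :
    ContDiff ℝ ∞ fun p : ℝ × ℝ => φ (hypRadius p.1 p.2) := by
  have hsmooth := contDiff_of_hasFDerivAt_family
    (α := {φ : ℝ → ℝ // IsFlatAt φ 0 ∧ φ 0 = 0} × ℕ)
    (fun a => a.1.2.1.hasFDerivAt_comp_hypRadius_div_pow a.1.2.2 a.2)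
    (fun n ih a => by
      have hderiv := ih (⟨_, a.1.2.1.deriv, a.1.2.1.deriv_eq_zero⟩, a.2 + 1)
      have hself := ih (a.1, a.2 + 2)
      fun_prop)
    (⟨_, hφ.sub_const (φ 0), sub_self _⟩, 0)
  simpa using hsmooth.add (contDiff_const (c := φ 0))

end FlatComp

/-! ### Linear flows -/

section LinearFlow

variable {κ : Type} [Fintype κ] [DecidableEq κ] (A : Matrix κ κ ℝ)

section

attribute [local instance] Matrix.linftyOpNormedRing Matrix.linftyOpNormedAlgebra

theorem linearFlow_eq_exp_toEuclideanCLM (t : ℝ) (v : Eucl κ) :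
    linearFlow A t v = NormedSpace.exp (t • Matrix.toEuclideanCLM (𝕜 := ℝ) A) v := by
  have hcont : Continuous (Matrix.toEuclideanCLM (n := κ) (𝕜 := ℝ)) :=
    LinearMap.continuous_of_finiteDimensional
      (Matrix.toEuclideanCLM (n := κ) (𝕜 := ℝ)).toAlgEquiv.toLinearMap
  rw [← map_smul, ← NormedSpace.map_exp (Matrix.toEuclideanCLM (n := κ) (𝕜 := ℝ)) hcont (t • A)]
  rfl

end

theorem linearFlow_zero (v : Eucl κ) : linearFlow A 0 v = v := by
  simp [linearFlow]

theorem linearFlow_add (s t : ℝ) (v : Eucl κ) :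
    linearFlow A (s + t) v = linearFlow A s (linearFlow A t v) := by
  simp only [linearFlow]
  rw [add_smul, Matrix.exp_add_of_commute _ _ ((Commute.refl A).smul_left s |>.smul_right t),
    Matrix.mulVec_mulVec]

theorem contDiff_linearFlow : ContDiff ℝ ∞ fun p : ℝ × Eucl κ => linearFlow A p.1 p.2 := by
  simp only [linearFlow_eq_exp_toEuclideanCLM]
  have hexp : ContDiff ℝ ∞ (NormedSpace.exp : (Eucl κ →L[ℝ] Eucl κ) → Eucl κ →L[ℝ] Eucl κ) :=
    contDiff_iff_contDiffAt.2 fun L => (NormedSpace.exp_analytic L).contDiffAt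
  exact (hexp.comp (by fun_prop)).clm_apply contDiff_snd

theorem hasDerivAt_linearFlow (v : Eucl κ) (t : ℝ) :
    HasDerivAt (fun t => linearFlow A t v)
      (WithLp.toLp 2 (A.mulVec (linearFlow A t v).ofLp)) t := by
  have hderiv := (hasDerivAt_exp_smul_const' (𝕂 := ℝ) (Matrix.toEuclideanCLM (𝕜 := ℝ) A)
    t).clm_apply (hasDerivAt_const t v)
  simp only [linearFlow_eq_exp_toEuclideanCLM]
  exact hderiv.congr_deriv (by rw [map_zero, add_zero]; rfl)

theorem linearFlow_eq_of_hasDerivAt {c : ℝ → Eucl κ}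
    (hc : ∀ t, HasDerivAt c (WithLp.toLp 2 (A.mulVec (c t).ofLp)) t) (t : ℝ) :
    linearFlow A t (c 0) = c t := by
  have hconst (s : ℝ) : HasDerivAt (fun s => linearFlow A (-s) (c s)) 0 s := by
    have hneg (s : ℝ) (v : Eucl κ) : linearFlow A (-s) v = linearFlow (-A) s v := by
      rw [linearFlow, linearFlow, neg_smul, smul_neg]
    have hderiv := (hasDerivAt_exp_smul_const (𝕂 := ℝ) (Matrix.toEuclideanCLM (𝕜 := ℝ) (-A))
      s).clm_apply (hc s)
    simp only [hneg, linearFlow_eq_exp_toEuclideanCLM]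
    have hcancel : Matrix.toEuclideanCLM (𝕜 := ℝ) (-A) (c s) +
        WithLp.toLp 2 (A.mulVec (c s).ofLp) = 0 := by
      ext i
      simp
    refine hderiv.congr_deriv ?_
    rw [mul_apply_eq_comp, ← map_add, hcancel, map_zero]
  have heq := is_const_of_deriv_eq_zero (fun s => (hconst s).differentiableAt)
    (fun s => (hconst s).deriv) t 0
  simp only [neg_zero, linearFlow_zero] at heq
  rw [← heq, ← linearFlow_add, add_neg_cancel, linearFlow_zero]

theorem linearFlow_apply_of_intertwines {κ' : Type} [Fintype κ'] [DecidableEq κ']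
    {B : Matrix κ' κ' ℝ} {K : Eucl κ →L[ℝ] Eucl κ'}
    (hK : ∀ v, K (WithLp.toLp 2 (A.mulVec v.ofLp)) = WithLp.toLp 2 (B.mulVec (K v).ofLp))
    (t : ℝ) (v : Eucl κ) : linearFlow B t (K v) = K (linearFlow A t v) := by
  have hflow := linearFlow_eq_of_hasDerivAt B (c := fun t => K (linearFlow A t v)) fun s =>
    (K.hasFDerivAt.comp_hasDerivAt s (hasDerivAt_linearFlow A v s)).congr_deriv (hK _)
  simpa only [linearFlow_zero] using hflow t

end LinearFlow

theorem linearFlow_hyperbolicMatrix (t : ℝ) (v : Eucl (Fin 3)) :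
    linearFlow hyperbolicMatrix t v = !₂[Real.cosh t * v 0 + Real.sinh t * v 1,
      Real.sinh t * v 0 + Real.cosh t * v 1, v 2] := by
  let c : ℝ → Eucl (Fin 3) := fun t => !₂[Real.cosh t * v 0 + Real.sinh t * v 1,
    Real.sinh t * v 0 + Real.cosh t * v 1, v 2]
  have hc (t : ℝ) :
      HasDerivAt c (WithLp.toLp 2 (hyperbolicMatrix.mulVec (c t).ofLp)) t := by
    suffices h : HasDerivAt (fun t => (c t).ofLp) (hyperbolicMatrix.mulVec (c t).ofLp) t from
      (PiLp.continuousLinearEquiv 2 ℝ fun _ => ℝ).symm.hasFDerivAt.comp_hasDerivAt t h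
    refine hasDerivAt_pi.2 fun i => ?_
    have hcosh := Real.hasDerivAt_cosh t
    have hsinh := Real.hasDerivAt_sinh t
    fin_cases i
    · simpa [hyperbolicMatrix, Matrix.mulVec, dotProduct, Fin.sum_univ_three, c] using
        (hcosh.mul_const (v 0)).fun_add (hsinh.mul_const (v 1))
    · simpa [hyperbolicMatrix, Matrix.mulVec, dotProduct, Fin.sum_univ_three, c] using
        (hsinh.mul_const (v 0)).fun_add (hcosh.mul_const (v 1))
    · simpa [hyperbolicMatrix, Matrix.mulVec, dotProduct, Fin.sum_univ_three, c] using
        hasDerivAt_const t (v 2)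
  have hc0 : c 0 = v := by
    ext i
    fin_cases i <;> simp [c]
  simpa only [hc0] using linearFlow_eq_of_hasDerivAt hyperbolicMatrix hc t

theorem linearFlow_hyperbolicMatrix_eq_self_iff {v : Eucl (Fin 3)} :
    (∀ t, linearFlow hyperbolicMatrix t v = v) ↔ v 0 = 0 ∧ v 1 = 0 := by
  simp only [linearFlow_hyperbolicMatrix]
  refine ⟨fun h => ?_, fun ⟨h0, h1⟩ t => ?_⟩
  · have hcosh := Real.one_lt_cosh.2 one_ne_zero
    have hsq := Real.cosh_sq 1
    have h0 : Real.cosh 1 * v 0 + Real.sinh 1 * v 1 = v 0 := congrArg (fun w => w 0) (h 1)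
    have h1 : Real.sinh 1 * v 0 + Real.cosh 1 * v 1 = v 1 := congrArg (fun w => w 1) (h 1)
    have hdet : Real.cosh 1 - 1 ≠ 0 := by linarith
    constructor
    · refine (mul_eq_zero.1 ?_ : Real.cosh 1 - 1 = 0 ∨ v 0 = 0).resolve_left hdet
      linear_combination -(Real.cosh 1 - 1) / 2 * h0 + Real.sinh 1 / 2 * h1 + v 0 / 2 * hsq
    · refine (mul_eq_zero.1 ?_ : Real.cosh 1 - 1 = 0 ∨ v 1 = 0).resolve_left hdet
      linear_combination -(Real.cosh 1 - 1) / 2 * h1 + Real.sinh 1 / 2 * h0 + v 1 / 2 * hsq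
  · ext i
    fin_cases i <;> simp [h0, h1]

theorem hypRadius_linearFlow (t : ℝ) (p : Eucl (Fin 3)) :
    hypRadius (linearFlow hyperbolicMatrix t p 0) (linearFlow hyperbolicMatrix t p 1) =
      hypRadius (p 0) (p 1) := by
  have hpos {v y : ℝ} (h : |y| < v) :
      0 < Real.cosh t * v + Real.sinh t * y ∧ 0 < v := by
    have hv := (abs_nonneg y).trans_lt h
    refine ⟨?_, hv⟩
    have habs : |Real.sinh t * y| < Real.cosh t * v := by
      rw [abs_mul]
      exact mul_lt_mul'' (abs_lt.2 ⟨by linarith [Real.exp_pos t, Real.cosh_add_sinh t],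
        Real.sinh_lt_cosh t⟩) h (abs_nonneg _) (abs_nonneg _)
    linarith [neg_abs_le (Real.sinh t * y)]
  have hsq : (Real.cosh t * p 0 + Real.sinh t * p 1) ^ 2 -
      (Real.sinh t * p 0 + Real.cosh t * p 1) ^ 2 = p 0 ^ 2 - p 1 ^ 2 := by
    linear_combination (p 0 ^ 2 - p 1 ^ 2) * Real.cosh_sq t
  rw [linearFlow_hyperbolicMatrix]
  change hypRadius (Real.cosh t * p 0 + Real.sinh t * p 1)
    (Real.sinh t * p 0 + Real.cosh t * p 1) = _
  rw [hypRadius, hypRadius, hsq]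
  rcases le_or_gt |p 0| |p 1| with hle | hlt
  · rw [Real.sqrt_eq_zero_of_nonpos (sub_nonpos.2 (sq_le_sq.2 hle)), mul_zero, mul_zero]
  · rcases lt_abs.1 hlt with h | h
    · rw [Real.sign_of_pos (hpos h).1, Real.sign_of_pos (hpos h).2]
    · have hneg := hpos (y := -p 1) ((abs_neg _).trans_lt h)
      rw [Real.sign_of_neg (by linarith [hneg.1]), Real.sign_of_neg (by linarith [hneg.2])]

theorem exists_eq_linearFlow_iff {p q : Eucl (Fin 3)} (h0 : q 0 ≠ 0) (h1 : q 1 = 0) :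
    (∃ t, p = linearFlow hyperbolicMatrix t q) ↔
      hypRadius (p 0) (p 1) = q 0 ∧ p 2 = q 2 := by
  constructor
  · rintro ⟨t, rfl⟩
    rw [hypRadius_linearFlow, h1, hypRadius_zero_right, linearFlow_hyperbolicMatrix]
    exact ⟨rfl, rfl⟩
  · rintro ⟨hradius, h2⟩
    have hp0 : q 0 * √(1 + (p 1 / q 0) ^ 2) = p 0 := by
      rw [← hypAbscissa_eq_mul_sqrt h0, ← hradius, hypAbscissa_hypRadius (hradius ▸ h0)]
    refine ⟨Real.arsinh (p 1 / q 0), ?_⟩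
    rw [linearFlow_hyperbolicMatrix, Real.cosh_arsinh, Real.sinh_arsinh, h1]
    ext i
    fin_cases i
    · simp [← hp0, mul_comm]
    · simp [h0]
    · exact h2

/-! ### Flows and linearizing embeddings -/

section Induced

variable {E F M : Type*} [NormedAddCommGroup E] [NormedSpace ℝ E] [FiniteDimensional ℝ E]
  [NormedAddCommGroup F] [NormedSpace ℝ F] [FiniteDimensional ℝ F]
  [NormedAddCommGroup M] [NormedSpace ℝ M]

theorem exists_contDiffAt_leftInverse {f : E → F} {x : E} (hf : ContDiffAt ℝ ∞ f x)
    (hinj : Function.Injective (fderiv ℝ f x)) :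
    ∃ g : F → E, ContDiffAt ℝ ∞ g (f x) ∧ ∀ᶠ y in 𝓝 x, g (f y) = y := by
  have : CompleteSpace E := FiniteDimensional.complete ℝ E
  obtain ⟨P, hP⟩ := (fderiv ℝ f x : E →ₗ[ℝ] F).exists_leftInverse_of_injective
    (LinearMap.ker_eq_bot.2 hinj)
  let Q : F →L[ℝ] E := LinearMap.toContinuousLinearMap P
  have hsmooth : ContDiffAt ℝ ∞ (Q ∘ f) x := Q.contDiff.contDiffAt.comp x hf
  have hderiv : HasFDerivAt (Q ∘ f) ((.refl ℝ E : E ≃L[ℝ] E) : E →L[ℝ] E) x := by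
    refine (Q.hasFDerivAt.comp x (hf.differentiableAt (by simp)).hasFDerivAt).congr_fderiv ?_
    ext v
    exact congrArg (fun L : E →ₗ[ℝ] E => L v) hP
  exact ⟨hsmooth.localInverse hderiv (by simp) ∘ Q,
    (hsmooth.to_localInverse hderiv (by simp)).comp (f x) Q.contDiff.contDiffAt,
    (hsmooth.hasStrictFDerivAt' hderiv (by simp)).eventually_left_inverse⟩

theorem contDiff_of_comp_embedding {f : E → F} (hf : ContDiff ℝ ∞ f)
    (hemb : Topology.IsEmbedding f) (himm : ∀ x, Function.Injective (fderiv ℝ f x)) {g : M → E}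
    (hg : ContDiff ℝ ∞ fun m => f (g m)) : ContDiff ℝ ∞ g := by
  have hcont : Continuous g := hemb.continuous_iff.2 hg.continuous
  refine contDiff_iff_contDiffAt.2 fun m => ?_
  obtain ⟨r, hr, hleft⟩ := exists_contDiffAt_leftInverse hf.contDiffAt (himm (g m))
  refine (hr.comp m hg.contDiffAt).congr_of_eventuallyEq ?_
  filter_upwards [hcont.continuousAt.eventually hleft] with m' hm' using hm'.symm

end Induced

/-- The flow `Φ` in the coordinates given by a linear isomorphism `L`. -/
def conjFlow {ι ι' : Type} (L : Eucl ι ≃L[ℝ] Eucl ι') (Φ : Flow ℝ (Eucl ι)) :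
    Flow ℝ (Eucl ι') where
  toFun t x := L (Φ t (L.symm x))
  cont' := L.continuous.comp (Φ.continuous continuous_fst (L.symm.continuous.comp continuous_snd))
  map_add' s t x := by simp [Φ.map_add]
  map_zero' x := by simp

theorem conjFlow_apply {ι ι' : Type} {L : Eucl ι ≃L[ℝ] Eucl ι'} {Φ : Flow ℝ (Eucl ι)} (t : ℝ)
    (x : Eucl ι') : conjFlow L Φ t x = L (Φ t (L.symm x)) := rfl

/-- The splitting of `ℝ^(ι ⊕ Fin m)`, on which `expandFlow` lives, into `ℝ^ι × ℝ^m`. -/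
noncomputable def sumEquiv (ι : Type) [Fintype ι] (m : ℕ) :
    Eucl (ι ⊕ Fin m) ≃L[ℝ] Eucl ι × Eucl (Fin m) :=
  EuclideanSpace.sumEquivProd

theorem expandMap_eq_comp {ι κ : Type} [Fintype ι] [Fintype κ] (m : ℕ) (f : Eucl ι → Eucl κ) :
    expandMap m f = (sumEquiv κ m).symm ∘ Prod.map f id ∘ sumEquiv ι m := rfl

section Flows

variable {ι ι' κ κ' : Type} [Fintype ι] [Fintype ι'] [Fintype κ] [DecidableEq κ] [Fintype κ']
  [DecidableEq κ'] {Φ : Flow ℝ (Eucl ι)} {A : Matrix κ κ ℝ} {f : Eucl ι → Eucl κ}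

theorem exists_flow_of_invariant_range (hf : ContDiff ℝ ∞ f) (hemb : Topology.IsEmbedding f)
    (himm : ∀ x, Function.Injective (fderiv ℝ f x))
    (hinv : ∀ t x, linearFlow A t (f x) ∈ Set.range f) :
    ∃ Φ : Flow ℝ (Eucl ι), IsSmoothFlow Φ ∧ IsLinearizingEmbedding Φ A f := by
  choose φ hφ using hinv
  have hsmooth : ContDiff ℝ ∞ fun p : ℝ × Eucl ι => φ p.1 p.2 := by
    refine contDiff_of_comp_embedding hf hemb himm ?_
    simp only [hφ]
    exact (contDiff_linearFlow A).comp (contDiff_fst.prodMk (hf.comp contDiff_snd))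
  let Φ : Flow ℝ (Eucl ι) :=
    { toFun := φ
      cont' := hsmooth.continuous
      map_add' := fun s t x => hemb.injective (by rw [hφ, hφ, hφ, linearFlow_add])
      map_zero' := fun x => hemb.injective (by rw [hφ, linearFlow_zero]) }
  exact ⟨Φ, hsmooth, hf, hemb, himm, fun t x => (hφ t x).symm⟩

theorem IsLinearizingEmbedding.mem_equilibria_iff (hf : IsLinearizingEmbedding Φ A f) {x : Eucl ι} :
    x ∈ equilibria Φ ↔ ∀ t, linearFlow A t (f x) = f x := by
  simp only [equilibria, Set.mem_ofPred_eq, hf.equivariant, hf.isEmbedding.injective.eq_iff]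

theorem IsLinearizingEmbedding.linearFlow_image_range (hf : IsLinearizingEmbedding Φ A f) (t : ℝ) :
    linearFlow A t '' Set.range f = Set.range f := by
  have hsurj : Function.Surjective (Φ t) := (Φ.toHomeomorph t).surjective
  rw [← Set.range_comp, ← hsurj.range_comp f]
  exact congrArg Set.range (funext (hf.equivariant t))

theorem hasIsolatedEquilibria_of_image {X : Type*} [TopologicalSpace X] {S : Set X}
    (hcount : S.Countable) (hisol : ∀ x ∈ S, ∃ U ∈ 𝓝 x, U ∩ S = {x}) {i : X → Eucl ι}
    {r : Eucl ι → X} (hr : Continuous r) (hri : Function.LeftInverse r i)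
    (himage : equilibria Φ = i '' S) : HasIsolatedEquilibria Φ S.encard where
  countable := himage ▸ hcount.image i
  encard_eq := by rw [himage, hri.injective.encard_image]
  isolated p hp := by
    rw [himage] at hp ⊢
    obtain ⟨x, hx, rfl⟩ := hp
    obtain ⟨U, hU, hUx⟩ := hisol x hx
    refine ⟨r ⁻¹' U, hr.continuousAt (by rwa [hri]), ?_⟩
    rw [Set.inter_comm, ← Set.image_inter_preimage, ← Set.preimage_comp, hri.comp_eq_id,
      Set.preimage_id, Set.inter_comm, hUx, Set.image_singleton]

protected theorem IsSmoothFlow.conjFlow (hΦ : IsSmoothFlow Φ) (L : Eucl ι ≃L[ℝ] Eucl ι') :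
    IsSmoothFlow (conjFlow L Φ) :=
  L.contDiff.comp (hΦ.comp (contDiff_fst.prodMk (L.symm.contDiff.comp contDiff_snd)))

theorem equilibria_conjFlow (L : Eucl ι ≃L[ℝ] Eucl ι') (Φ : Flow ℝ (Eucl ι)) :
    equilibria (conjFlow L Φ) = L '' equilibria Φ := by
  rw [L.image_eq_preimage_symm]
  ext x
  simp [equilibria, conjFlow_apply, ← L.eq_symm_apply]

protected theorem HasIsolatedEquilibria.conjFlow {ℓ : ℕ∞} (hΦ : HasIsolatedEquilibria Φ ℓ)
    (L : Eucl ι ≃L[ℝ] Eucl ι') : HasIsolatedEquilibria (conjFlow L Φ) ℓ := by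
  rw [← hΦ.encard_eq]
  exact hasIsolatedEquilibria_of_image hΦ.countable hΦ.isolated L.symm.continuous
    L.symm_apply_apply (equilibria_conjFlow L Φ)

protected theorem IsLinearizingEmbedding.conjFlow (hf : IsLinearizingEmbedding Φ A f)
    (L : Eucl ι ≃L[ℝ] Eucl ι') {B : Matrix κ' κ' ℝ} {K : Eucl κ ≃L[ℝ] Eucl κ'}
    (hK : ∀ v, K (WithLp.toLp 2 (A.mulVec v.ofLp)) = WithLp.toLp 2 (B.mulVec (K v).ofLp)) :
    IsLinearizingEmbedding (conjFlow L Φ) B (K ∘ f ∘ L.symm) where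
  smooth := K.contDiff.comp (hf.smooth.comp L.symm.contDiff)
  isEmbedding :=
    K.toHomeomorph.isEmbedding.comp (hf.isEmbedding.comp L.symm.toHomeomorph.isEmbedding)
  immersion x := by
    have hderiv := (hf.smooth.differentiable (by simp) (L.symm x)).hasFDerivAt
    rw [(K.hasFDerivAt.comp x (hderiv.comp x L.symm.hasFDerivAt)).fderiv]
    exact K.injective.comp ((hf.immersion _).comp L.symm.injective)
  equivariant t x := by
    have hflow := linearFlow_apply_of_intertwines A (K := (K : Eucl κ →L[ℝ] Eucl κ')) hK t
      (f (L.symm x))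
    simpa [conjFlow_apply, hf.equivariant] using hflow

theorem IsLinearizingEmbedding.admitsLinearizingEmbedding_conjFlow
    (hf : IsLinearizingEmbedding Φ A f) (L : Eucl ι ≃L[ℝ] Eucl ι') :
    AdmitsLinearizingEmbedding (conjFlow L Φ) := by
  let e := Fintype.equivFin κ
  refine ⟨Fintype.card κ, Matrix.reindex e e A, _, hf.conjFlow L
    (K := (LinearIsometryEquiv.piLpCongrLeft 2 ℝ ℝ e).toContinuousLinearEquiv) fun v => ?_⟩
  ext i
  change (A.mulVec v.ofLp) (e.symm i) =
    ((Matrix.reindex e e A).mulVec (v.ofLp ∘ e.symm)) i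
  rw [Matrix.reindex_apply, Matrix.submatrix_mulVec_equiv]
  simp [Function.comp_assoc]

/-! ### Adding expanding coordinates -/

theorem expandFlow_symm_apply (m : ℕ) (t : ℝ) (x : Eucl ι) (w : Eucl (Fin m)) :
    expandFlow m Φ t ((sumEquiv ι m).symm (x, w)) =
      (sumEquiv ι m).symm (Φ t x, Real.exp t • w) := rfl

protected theorem IsSmoothFlow.expandFlow (hΦ : IsSmoothFlow Φ) (m : ℕ) :
    IsSmoothFlow (expandFlow m Φ) := by
  let S := sumEquiv ι m
  suffices h : ContDiff ℝ ∞ fun q : ℝ × Eucl (ι ⊕ Fin m) =>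
      S.symm (Φ q.1 (S q.2).1, Real.exp q.1 • (S q.2).2) from h
  refine S.symm.contDiff.comp (.prodMk (hΦ.comp (contDiff_fst.prodMk ?_)) ?_)
  · exact contDiff_fst.comp (S.contDiff.comp contDiff_snd)
  · exact (Real.contDiff_exp.comp contDiff_fst).smul
      (contDiff_snd.comp (S.contDiff.comp contDiff_snd))

theorem equilibria_expandFlow (m : ℕ) (Φ : Flow ℝ (Eucl ι)) : equilibria (expandFlow m Φ) =
    (fun x => (sumEquiv ι m).symm (x, (0 : Eucl (Fin m)))) '' equilibria Φ := by
  ext p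
  obtain ⟨⟨x, w⟩, rfl⟩ := (sumEquiv ι m).symm.surjective p
  have hexp : Real.exp 1 - 1 ≠ 0 := (sub_pos.2 (Real.one_lt_exp_iff.2 one_pos)).ne'
  have hw : (∀ t : ℝ, Real.exp t • w = w) ↔ w = 0 := by
    refine ⟨fun h => (smul_eq_zero.1 ?_).resolve_left hexp, fun h t => by rw [h, smul_zero]⟩
    rw [sub_smul, one_smul, h 1, sub_self]
  simp only [equilibria, Set.mem_ofPred_eq, expandFlow_symm_apply, EmbeddingLike.apply_eq_iff_eq,
    Prod.mk.injEq, forall_and, hw, Set.mem_image]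
  exact ⟨fun ⟨hx, hw⟩ => ⟨x, hx, rfl, hw.symm⟩, by rintro ⟨_, hx, rfl, rfl⟩; exact ⟨hx, rfl⟩⟩

protected theorem HasIsolatedEquilibria.expandFlow {ℓ : ℕ∞} (hΦ : HasIsolatedEquilibria Φ ℓ)
    (m : ℕ) : HasIsolatedEquilibria (expandFlow m Φ) ℓ := by
  rw [← hΦ.encard_eq]
  exact hasIsolatedEquilibria_of_image hΦ.countable hΦ.isolated
    (continuous_fst.comp (sumEquiv ι m).continuous)
    (fun x => by simp) (equilibria_expandFlow m Φ)

theorem linearFlow_fromBlocks_one (m : ℕ) (A : Matrix κ κ ℝ) (t : ℝ) (v : Eucl κ)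
    (w : Eucl (Fin m)) :
    linearFlow (Matrix.fromBlocks A 0 0 1) t ((sumEquiv κ m).symm (v, w)) =
      (sumEquiv κ m).symm (linearFlow A t v, Real.exp t • w) := by
  let S := sumEquiv κ m
  have hderiv (t : ℝ) : HasDerivAt (fun t => S.symm (linearFlow A t v, Real.exp t • w))
      (WithLp.toLp 2 ((Matrix.fromBlocks A 0 0 1).mulVec
        (S.symm (linearFlow A t v, Real.exp t • w)).ofLp)) t := by
    refine (S.symm.hasFDerivAt.comp_hasDerivAt t ((hasDerivAt_linearFlow A v t).prodMk
      ((Real.hasDerivAt_exp t).smul_const w))).congr_deriv ?_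
    change _ = WithLp.toLp 2 (Matrix.mulVec _ (Sum.elim _ _))
    rw [Matrix.fromBlocks_mulVec, Matrix.zero_mulVec, Matrix.zero_mulVec, Matrix.one_mulVec,
      add_zero, zero_add]
    rfl
  simpa only [S, linearFlow_zero, Real.exp_zero, one_smul] using
    linearFlow_eq_of_hasDerivAt _ hderiv t

protected theorem IsLinearizingEmbedding.expandMap (hf : IsLinearizingEmbedding Φ A f) (m : ℕ) :
    IsLinearizingEmbedding (expandFlow m Φ) (Matrix.fromBlocks A 0 0 1) (expandMap m f) where
  smooth := by
    rw [expandMap_eq_comp]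
    exact (sumEquiv κ m).symm.contDiff.comp
      ((hf.smooth.prodMap contDiff_id).comp (sumEquiv ι m).contDiff)
  isEmbedding := by
    rw [expandMap_eq_comp]
    exact (sumEquiv κ m).symm.toHomeomorph.isEmbedding.comp
      ((hf.isEmbedding.prodMap .id).comp (sumEquiv ι m).toHomeomorph.isEmbedding)
  immersion p := by
    have hprod : HasFDerivAt (Prod.map f id)
        ((fderiv ℝ f (sumEquiv ι m p).1).prodMap (.id ℝ (Eucl (Fin m)))) (sumEquiv ι m p) :=
      (hf.smooth.differentiable (by simp) _).hasFDerivAt.prodMap _ (hasFDerivAt_id _)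
    have hderiv := (sumEquiv κ m).symm.hasFDerivAt.comp p (hprod.comp p (sumEquiv ι m).hasFDerivAt)
    rw [expandMap_eq_comp, hderiv.fderiv]
    exact (sumEquiv κ m).symm.injective.comp
      (((hf.immersion _).prodMap Function.injective_id).comp (sumEquiv ι m).injective)
  equivariant t p := by
    obtain ⟨⟨x, w⟩, rfl⟩ := (sumEquiv ι m).symm.surjective p
    rw [expandFlow_symm_apply]
    change linearFlow _ t ((sumEquiv κ m).symm (f x, w)) =
      (sumEquiv κ m).symm (f (Φ t x), Real.exp t • w)
    rw [linearFlow_fromBlocks_one, hf.equivariant]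

end Flows

/-! ### Extending a local diffeomorphism of the line -/

section Diffeomorph

open scoped Manifold

variable {f : ℝ → ℝ} {a c : ℝ}

theorem exists_eventuallyEq_le_deriv (hf : ContDiff ℝ ∞ f) (ha : a < deriv f c) :
    ∃ g : ℝ → ℝ, ContDiff ℝ ∞ g ∧ g =ᶠ[𝓝 c] f ∧ ∀ s, a ≤ deriv g s := by
  have hf' := (contDiff_infty_iff_deriv.1 hf).2
  obtain ⟨r, hr, hball⟩ := Metric.eventually_nhds_iff.1
    (hf'.continuous.continuousAt.eventually (lt_mem_nhds ha))
  let χ : ContDiffBump c := ⟨r / 3, r / 2, by positivity, by linarith⟩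
  let g' : ℝ → ℝ := fun s => χ s * deriv f s + (1 - χ s) * a
  have hg' : ContDiff ℝ ∞ g' :=
    (χ.contDiff.mul hf').add ((contDiff_const.sub χ.contDiff).mul contDiff_const)
  let g : ℝ → ℝ := fun s => f c + ∫ u in c..s, g' u
  have hg (s : ℝ) : HasDerivAt g (g' s) s :=
    (hg'.continuous.integral_hasStrictDerivAt c s).hasDerivAt.const_add (f c)
  have hderiv : deriv g = g' := funext fun s => (hg s).deriv
  refine ⟨g, contDiff_infty_iff_deriv.2 ⟨fun s => (hg s).differentiableAt, hderiv ▸ hg'⟩, ?_,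
    fun s => ?_⟩
  · filter_upwards [Metric.closedBall_mem_nhds c (by positivity : 0 < r / 3)] with s hs
    have hcongr : ∫ u in c..s, g' u = ∫ u in c..s, deriv f u := by
      refine intervalIntegral.integral_congr fun u hu => ?_
      have hχ : χ u = 1 := χ.one_of_mem_closedBall <| by
        simpa [χ, Real.dist_eq] using (Set.abs_sub_left_of_mem_uIcc hu).trans
          (by simpa [Real.dist_eq] using hs)
      simp [g', hχ]
    have hftc : ∫ u in c..s, deriv f u = f s - f c :=
      intervalIntegral.integral_deriv_eq_sub (fun u _ => hf.differentiable (by simp) u)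
        (hf'.continuous.intervalIntegrable _ _)
    simp only [g, hcongr, hftc, add_sub_cancel]
  · rw [hderiv]
    by_cases hs : dist s c < r
    · nlinarith [hball hs, χ.nonneg (x := s)]
    · have hχ : χ s = 0 := χ.zero_of_le_dist (by simp only [χ]; linarith)
      simp [g', hχ]

theorem exists_diffeomorph_of_le_deriv (hf : ContDiff ℝ ∞ f) (ha : 0 < a)
    (hderiv : ∀ s, a ≤ deriv f s) : ∃ ξ : ℝ ≃ₘ[ℝ] ℝ, ⇑ξ = f := by
  have hf' (s : ℝ) : HasDerivAt f (deriv f s) s := (hf.differentiable (by simp) s).hasDerivAt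
  have hmono : StrictMono f := strictMono_of_deriv_pos fun s => ha.trans_le (hderiv s)
  have hgrow : Monotone fun s => f s - a * s := by
    have h (s : ℝ) : HasDerivAt (fun s => f s - a * s) (deriv f s - a * 1) s :=
      (hf' s).sub ((hasDerivAt_id s).const_mul a)
    refine monotone_of_deriv_nonneg (fun s => (h s).differentiableAt) fun s => ?_
    linarith [(h s).deriv, hderiv s]
  have hline : Filter.Tendsto (fun s => a * s + f 0) Filter.atTop Filter.atTop :=
    Filter.tendsto_atTop_add_const_right _ _ (Filter.tendsto_id.const_mul_atTop ha)
  have hline' : Filter.Tendsto (fun s => a * s + f 0) Filter.atBot Filter.atBot :=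
    Filter.tendsto_atBot_add_const_right _ _ (Filter.tendsto_id.const_mul_atBot ha)
  have hsurj : Function.Surjective f := by
    refine hf.continuous.surjective (Filter.tendsto_atTop_mono' _ ?_ hline)
      (Filter.tendsto_atBot_mono' _ ?_ hline')
    · filter_upwards [Filter.eventually_ge_atTop 0] with s hs
      linarith [hgrow hs]
    · filter_upwards [Filter.eventually_le_atBot 0] with s hs
      linarith [hgrow hs]
  let H : ℝ ≃ₜ ℝ := (hmono.orderIsoOfSurjective f hsurj).toHomeomorph
  have hsymm : ContDiff ℝ ∞ H.symm :=
    H.contDiff_symm_deriv (fun s => (ha.trans_le (hderiv s)).ne') hf' hf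
  exact ⟨⟨H.toEquiv, hf.contMDiff, hsymm.contMDiff⟩, rfl⟩

theorem exists_diffeomorph_eventuallyEq (hf : ContDiff ℝ ∞ f) (hc : deriv f c ≠ 0) :
    ∃ ξ : ℝ ≃ₘ[ℝ] ℝ, ξ =ᶠ[𝓝 c] f := by
  wlog hpos : 0 < deriv f c generalizing f
  · obtain ⟨ξ, hξ⟩ := this (f := fun s => -f s) hf.neg (by simpa using hc)
      (by simpa using lt_of_le_of_ne (not_lt.1 hpos) hc)
    refine ⟨ξ.trans (ContinuousLinearEquiv.neg ℝ).toDiffeomorph, ?_⟩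
    filter_upwards [hξ] with s hs
    simp [hs]
  obtain ⟨g, hg, hgf, hderiv⟩ := exists_eventuallyEq_le_deriv hf (half_lt_self hpos)
  obtain ⟨ξ, rfl⟩ := exists_diffeomorph_of_le_deriv hg (half_pos hpos) hderiv
  exact ⟨ξ, hgf⟩

theorem deriv_diffeomorph_ne_zero (ξ : ℝ ≃ₘ[ℝ] ℝ) (s : ℝ) : deriv ξ s ≠ 0 := by
  have hξ : HasDerivAt ξ (deriv ξ s) s := (ξ.contDiff.differentiable (by simp) s).hasDerivAt
  have hsymm : HasDerivAt ξ.symm _ (ξ s) :=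
    (ξ.symm.contDiff.differentiable (by simp) _).hasDerivAt
  have hid := (hsymm.comp s hξ).unique
    ((hasDerivAt_id s).congr_of_eventuallyEq (.of_forall ξ.symm_apply_apply))
  exact right_ne_zero_of_mul_eq_one hid

end Diffeomorph

/-! ### Collars of the zeros of a profile -/

section Collar

open scoped Manifold

/-- A diffeomorphism of the line that vanishes at `center`, together with a width. A collar models
the surface `z = φ (hypRadius x y)` near the plane `x = 0`: in a neighbourhood of `center`, the
parameter `s` stands for the coordinate `x = chart s`, and at distances beyond the width, it
stands for the value `chart s` of `hypRadius x y`. -/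
structure Collar where
  center : ℝ
  width : ℝ
  width_pos : 0 < width
  chart : ℝ ≃ₘ[ℝ] ℝ
  chart_center : chart center = 0

namespace Collar

variable (C : Collar) {s y : ℝ}

/-- The cutoff that switches between the two roles of the parameter of a collar. -/
noncomputable def cutoff (s : ℝ) : ℝ :=
  Real.smoothTransition (4 * ((s - C.center) / C.width) ^ 2 - 1)

/-- The coordinate `x` of the point of the surface with parameters `s` and `y`. -/
noncomputable def abscissa (s y : ℝ) : ℝ := hypAbscissa (C.chart s) (C.cutoff s * y)

/-- The parameter of the point in which the orbit through the point with parameters `s` and `y`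
meets the plane `y = 0`, and `center` if it does not meet this plane outside the line `x = 0`. -/
noncomputable def foot (s y : ℝ) : ℝ := C.chart.symm (hypRadius (C.abscissa s y) y)

theorem chart_foot (s y : ℝ) : C.chart (C.foot s y) = hypRadius (C.abscissa s y) y :=
  C.chart.apply_symm_apply _

theorem contDiff_cutoff : ContDiff ℝ ∞ C.cutoff :=
  Real.smoothTransition.contDiff.comp (by fun_prop)

theorem abs_cutoff_le_one (s : ℝ) : |C.cutoff s| ≤ 1 :=
  abs_le.2 ⟨neg_one_lt_zero.le.trans (Real.smoothTransition.nonneg _),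
    Real.smoothTransition.le_one _⟩

theorem cutoff_eventuallyEq_zero : C.cutoff =ᶠ[𝓝 C.center] 0 := by
  have hcont : Continuous fun s => 4 * ((s - C.center) / C.width) ^ 2 - 1 := by fun_prop
  filter_upwards [hcont.continuousAt.eventually_lt continuousAt_const
    (show 4 * ((C.center - C.center) / C.width) ^ 2 - 1 < 0 by norm_num)] with s hs
  exact Real.smoothTransition.zero_of_nonpos hs.le

theorem cutoff_eq_one (hs : 3 / 4 * C.width ≤ |s - C.center|) : C.cutoff s = 1 := by
  refine Real.smoothTransition.one_of_one_le ?_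
  have hratio : 3 / 4 ≤ |(s - C.center) / C.width| := by
    rwa [abs_div, abs_of_pos C.width_pos, le_div_iff₀ C.width_pos]
  nlinarith [sq_abs ((s - C.center) / C.width)]

theorem mul_deriv_cutoff_nonneg (s : ℝ) : 0 ≤ (s - C.center) * deriv C.cutoff s := by
  have hpoly : HasDerivAt (fun s => 4 * ((s - C.center) / C.width) ^ 2 - 1)
      (8 / C.width ^ 2 * (s - C.center)) s := by
    refine ((((((hasDerivAt_id s).sub_const C.center).div_const C.width).fun_pow 2).const_mul
      4).sub_const 1).congr_deriv ?_
    simp only [id]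
    ring
  have hderiv := (((Real.smoothTransition.contDiff (n := 1)).differentiable (by simp)
    _).hasDerivAt).comp s hpoly
  rw [show deriv C.cutoff s = _ from hderiv.deriv, mul_left_comm, mul_left_comm _ _ (s - _)]
  exact mul_nonneg Real.smoothTransition.monotone.deriv_nonneg
    (mul_nonneg (by positivity) (mul_self_nonneg _))

theorem contDiff_chart : ContDiff ℝ ∞ C.chart := C.chart.contDiff

theorem chart_eq_zero_iff : C.chart s = 0 ↔ s = C.center := by
  rw [← C.chart_center, EmbeddingLike.apply_eq_iff_eq]

theorem hasDerivAt_chart (s : ℝ) : HasDerivAt C.chart (deriv C.chart s) s :=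
  (C.contDiff_chart.differentiable (by simp) s).hasDerivAt

theorem deriv_chart_ne_zero (s : ℝ) : deriv C.chart s ≠ 0 :=
  deriv_diffeomorph_ne_zero C.chart s

theorem mul_chart_mul_deriv_chart_pos (hs : s ≠ C.center) :
    0 < (s - C.center) * (C.chart s * deriv C.chart s) := by
  refine lt_of_le_of_ne ?_ (mul_ne_zero (sub_ne_zero.2 hs) (mul_ne_zero
    (C.chart_eq_zero_iff.not.2 hs) (C.deriv_chart_ne_zero s))).symm
  rw [← mul_assoc]
  rcases C.chart.continuous.strictMono_of_inj C.chart.injective with hmono | hanti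
  · have hmul := (hmono.monotone.monovary monotone_id).sub_mul_sub_nonneg C.center s
    rw [C.chart_center, sub_zero, mul_comm] at hmul
    exact mul_nonneg hmul hmono.monotone.deriv_nonneg
  · have hmul := (hanti.antitone.antivary monotone_id).sub_mul_sub_nonpos C.center s
    rw [C.chart_center, sub_zero, mul_comm] at hmul
    exact mul_nonneg_of_nonpos_of_nonpos hmul hanti.antitone.deriv_nonpos

theorem contDiff_abscissa : ContDiff ℝ ∞ fun p : ℝ × ℝ => C.abscissa p.1 p.2 := by
  have hchart : ContDiff ℝ ∞ fun p : ℝ × ℝ => C.chart p.1 := C.contDiff_chart.comp contDiff_fst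
  have hcutoff : ContDiff ℝ ∞ fun p : ℝ × ℝ => C.cutoff p.1 * p.2 :=
    (C.contDiff_cutoff.comp contDiff_fst).mul contDiff_snd
  refine contDiff_iff_contDiffAt.2 fun p => ?_
  by_cases hp : p.1 = C.center
  · refine hchart.contDiffAt.congr_of_eventuallyEq ?_
    filter_upwards [continuous_fst.continuousAt.eventually (hp ▸ C.cutoff_eventuallyEq_zero)]
      with q hq
    simp [abscissa, hq, hypAbscissa_zero_right]
  · exact (contDiffAt_hypAbscissa (p := (C.chart p.1, C.cutoff p.1 * p.2))
      (C.chart_eq_zero_iff.not.2 hp)).comp p (hchart.prodMk hcutoff).contDiffAt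

theorem differentiableAt_abscissa (s y : ℝ) : DifferentiableAt ℝ (fun s => C.abscissa s y) s :=
  (C.contDiff_abscissa.comp (contDiff_id.prodMk contDiff_const)).differentiable (by simp) s

theorem abscissa_center (y : ℝ) : C.abscissa C.center y = 0 := by
  simp [abscissa, C.chart_center, hypAbscissa]

theorem sq_abscissa (hs : s ≠ C.center) (y : ℝ) :
    C.abscissa s y ^ 2 = C.chart s ^ 2 + (C.cutoff s * y) ^ 2 :=
  sq_hypAbscissa (C.chart_eq_zero_iff.not.2 hs) _

theorem deriv_abscissa_ne_zero (s y : ℝ) : deriv (fun s => C.abscissa s y) s ≠ 0 := by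
  by_cases hs : s = C.center
  · have heq : (fun s => C.abscissa s y) =ᶠ[𝓝 s] C.chart := by
      filter_upwards [hs ▸ C.cutoff_eventuallyEq_zero] with u hu
      simp [abscissa, hu, hypAbscissa_zero_right]
    exact heq.deriv_eq ▸ C.deriv_chart_ne_zero s
  · intro hzero
    have heq : (fun s => C.abscissa s y ^ 2) =ᶠ[𝓝 s]
        fun s => C.chart s ^ 2 + (C.cutoff s * y) ^ 2 := by
      filter_upwards [isOpen_ne.mem_nhds hs] with u hu using C.sq_abscissa hu y
    have hcutoff : HasDerivAt C.cutoff (deriv C.cutoff s) s :=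
      (C.contDiff_cutoff.differentiable (by simp) s).hasDerivAt
    have hleft := (C.differentiableAt_abscissa s y).hasDerivAt.fun_pow 2
    have hright := ((C.hasDerivAt_chart s).fun_pow 2).fun_add ((hcutoff.mul_const y).fun_pow 2)
    have hderiv := (hleft.congr_of_eventuallyEq heq.symm).unique hright
    rw [hzero] at hderiv
    have hcut : 0 ≤ (s - C.center) * deriv C.cutoff s * (C.cutoff s * y ^ 2) :=
      mul_nonneg (C.mul_deriv_cutoff_nonneg s)
        (mul_nonneg (Real.smoothTransition.nonneg _) (sq_nonneg y))
    have hchart := C.mul_chart_mul_deriv_chart_pos hs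
    have hsum : 0 = (s - C.center) * (C.chart s * deriv C.chart s) +
        (s - C.center) * deriv C.cutoff s * (C.cutoff s * y ^ 2) := by
      linear_combination (s - C.center) / 2 * hderiv
    linarith

theorem injective_abscissa (y : ℝ) : Function.Injective fun s => C.abscissa s y := by
  intro s t hst
  by_contra hne
  wlog hlt : s < t generalizing s t
  · exact this hst.symm (Ne.symm hne) (lt_of_le_of_ne (not_lt.1 hlt) (Ne.symm hne))
  obtain ⟨u, -, hu⟩ := exists_deriv_eq_zero hlt
    (fun u _ => (C.differentiableAt_abscissa u y).continuousAt.continuousWithinAt) hst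
  exact C.deriv_abscissa_ne_zero u y hu

theorem surjective_abscissa (y : ℝ) : Function.Surjective fun s => C.abscissa s y := by
  intro v
  have hcont : Continuous fun s => C.abscissa s y :=
    C.contDiff_abscissa.continuous.comp (.prodMk_left y)
  have hmem : v ∈ Set.uIcc (C.abscissa C.center y) (C.abscissa (C.chart.symm v) y) := by
    rw [abscissa_center, abscissa, C.chart.apply_symm_apply]
    exact mem_uIcc_hypAbscissa _ _
  obtain ⟨s, -, hs⟩ := intermediate_value_uIcc hcont.continuousOn hmem
  exact ⟨s, hs⟩

theorem foot_eq_self (hs : 3 / 4 * C.width ≤ |s - C.center|) (y : ℝ) : C.foot s y = s := by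
  have hne : s ≠ C.center := by
    rintro rfl
    rw [sub_self, abs_zero] at hs
    linarith [C.width_pos]
  rw [foot, abscissa, C.cutoff_eq_one hs, one_mul,
    hypRadius_hypAbscissa (C.chart_eq_zero_iff.not.2 hne), C.chart.symm_apply_apply]

theorem foot_mem_uIcc (s y : ℝ) : C.foot s y ∈ Set.uIcc C.center s := by
  have hw : |C.cutoff s * y| ≤ |y| := by
    rw [abs_mul]
    exact mul_le_of_le_one_left (abs_nonneg y) (C.abs_cutoff_le_one s)
  have hmem : C.foot s y ∈ C.chart.symm '' Set.uIcc (C.chart C.center) (C.chart s) :=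
    Set.mem_image_of_mem _ (C.chart_center ▸ hypRadius_hypAbscissa_mem_uIcc (C.chart s) hw)
  suffices h : C.chart.symm '' Set.uIcc (C.chart C.center) (C.chart s) ⊆ Set.uIcc C.center s from
    h hmem
  nth_rw 2 [← C.chart.symm_apply_apply C.center, ← C.chart.symm_apply_apply s]
  rcases C.chart.symm.continuous.strictMono_of_inj C.chart.symm.injective with hmono | hanti
  · exact hmono.monotone.image_uIcc_subset
  · exact hanti.antitone.image_uIcc_subset

theorem abs_foot_sub_center_le (s y : ℝ) : |C.foot s y - C.center| ≤ |s - C.center| :=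
  Set.abs_sub_left_of_mem_uIcc (C.foot_mem_uIcc s y)

theorem contDiff_comp_foot {g : ℝ → ℝ} (hg : IsFlatAt g C.center) :
    ContDiff ℝ ∞ fun p : ℝ × ℝ => g (C.foot p.1 p.2) := by
  have hsymm : C.chart.symm 0 = C.center := by
    rw [← C.chart_center, C.chart.symm_apply_apply]
  have hflat : IsFlatAt (fun u => g (C.chart.symm u)) 0 :=
    IsFlatAt.comp (hsymm ▸ hg) C.chart.symm.contDiff
  exact hflat.contDiff_comp_hypRadius.comp (C.contDiff_abscissa.prodMk contDiff_snd)

end Collar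

end Collar

theorem Collar.exists_eqOn_chart {f : ℝ → ℝ} {c r : ℝ} (hf : ContDiff ℝ ∞ f) (hzero : f c = 0)
    (hderiv : deriv f c ≠ 0) (hr : 0 < r) : ∃ C : Collar, C.center = c ∧ C.width ≤ r ∧
      Set.EqOn C.chart f (Metric.closedBall c C.width) := by
  obtain ⟨ξ, hξ⟩ := exists_diffeomorph_eventuallyEq hf hderiv
  obtain ⟨δ, hδ, hball⟩ := Metric.nhds_basis_closedBall.eventually_iff.1 hξ
  refine ⟨⟨c, min δ r, lt_min hδ hr, ξ, hξ.self_of_nhds.trans hzero⟩, rfl, min_le_right _ _, ?_⟩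
  exact fun s hs => hball (Metric.closedBall_subset_closedBall (min_le_left _ _) hs)

/-! ### The surface over a profile -/

/-- The curve `s ↦ (x s, 0, z s)` is a profile if it is injective, regular and proper, and if it
crosses the line `x = 0`, tangentially to infinite order to the planes `z = const`, only at integer
times. The orbits through a profile then sweep out, together with the missing parts of those planes,
a smooth surface. -/
structure IsProfile (x z : ℝ → ℝ) : Prop where
  contDiff_left : ContDiff ℝ ∞ x
  contDiff_right : ContDiff ℝ ∞ z
  injective : ∀ s t, x s = x t → z s = z t → s = t
  regular : ∀ s, deriv x s = 0 → deriv z s ≠ 0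
  eq_intCast : ∀ s, x s = 0 → ∃ n : ℤ, s = n
  flat : ∀ s, x s = 0 → IsFlatAt z s
  isBounded : ∀ M, Bornology.IsBounded {s | |x s| ≤ M ∧ |z s| ≤ M}

/-- The union of the orbits of `x' = y, y' = x, z' = 0` that meet the curve `s ↦ (x s, 0, z s)`, and
of the sets `|x| ≤ |y|` in the planes `z = z s` with `x s = 0`. -/
def profileSurface (x z : ℝ → ℝ) : Set (Eucl (Fin 3)) :=
  {p | ∃ u, hypRadius (p 0) (p 1) = x u ∧ p 2 = z u}

/-- `C n` is a collar of the zero `n` of `x`, for all integers `n` at which `x` vanishes. -/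
def IsCollarFamily (x : ℝ → ℝ) (C : ℤ → Collar) : Prop :=
  ∀ n : ℤ, x n = 0 → (C n).center = n ∧ (C n).width ≤ 1 / 3 ∧
    Set.EqOn (C n).chart x (Metric.closedBall n (C n).width)

open Classical in
/-- The coordinate `x` of the point with parameters `s` and `y` on the surface over a profile,
together with the parameter of the point of the profile on (or nearest to) the same orbit. -/
noncomputable def profileParam (x : ℝ → ℝ) (C : ℤ → Collar) (s y : ℝ) : ℝ × ℝ :=
  if x (round s) = 0 ∧ |s - round s| ≤ (C (round s)).width then
    ((C (round s)).abscissa s y, (C (round s)).foot s y)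
  else (hypAbscissa (x s) y, s)

/-- The parametrization of the surface over a profile by the plane. -/
noncomputable def profileMap (x z : ℝ → ℝ) (C : ℤ → Collar) (q : Eucl (Fin 2)) : Eucl (Fin 3) :=
  !₂[(profileParam x C (q 0) (q 1)).1, q 1, z (profileParam x C (q 0) (q 1)).2]

theorem IsProfile.exists_isCollarFamily {x z : ℝ → ℝ} (hxz : IsProfile x z) :
    ∃ C, IsCollarFamily x C := by
  have hcollar (n : ℤ) (hn : x n = 0) := Collar.exists_eqOn_chart hxz.contDiff_left hn
    (mt (hxz.regular n) (not_not.2 (hxz.flat n hn).deriv_eq_zero)) (r := 1 / 3) (by norm_num)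
  have : Nonempty Collar := ⟨0, 1, one_pos, .refl _ _ _, rfl⟩
  choose! C hC using hcollar
  exact ⟨C, hC⟩

theorem IsProfile.apply_ne_zero {x z : ℝ → ℝ} {C : ℤ → Collar} {s : ℝ} (hxz : IsProfile x z)
    (hs : ∀ n : ℤ, x n = 0 → (C n).width ≤ |s - n|) : x s ≠ 0 := by
  intro hzero
  obtain ⟨n, rfl⟩ := hxz.eq_intCast s hzero
  have hle := hs n hzero
  rw [sub_self, abs_zero] at hle
  exact hle.not_gt (C n).width_pos

namespace IsCollarFamily

variable {x z : ℝ → ℝ} {C : ℤ → Collar} {n : ℤ} {s y : ℝ}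

theorem chart_eq (hC : IsCollarFamily x C) (hn : x n = 0) (hs : |s - n| ≤ (C n).width) :
    (C n).chart s = x s :=
  (hC n hn).2.2 (by simpa [Real.dist_eq] using hs)

theorem eq_of_abs_sub_lt (hC : IsCollarFamily x C) {m : ℤ} (hn : x n = 0)
    (hs : |s - n| ≤ (C n).width) (hm : |s - m| < 2 / 3) : m = n := by
  have hwidth := (hC n hn).2.1
  have hlt : |((m - n : ℤ) : ℝ)| < 1 := by
    push_cast
    rw [abs_lt] at hm ⊢
    rw [abs_le] at hs
    constructor <;> linarith
  exact sub_eq_zero.1 (Int.abs_lt_one_iff.1 (by exact_mod_cast hlt))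

theorem profileParam_eq_collar (hC : IsCollarFamily x C) (hn : x n = 0)
    (hs : |s - n| ≤ (C n).width) (y : ℝ) :
    profileParam x C s y = ((C n).abscissa s y, (C n).foot s y) := by
  have hround : round s = n :=
    hC.eq_of_abs_sub_lt hn hs ((abs_sub_round s).trans_lt (by norm_num))
  rw [profileParam, hround, if_pos ⟨hn, hs⟩]

theorem profileParam_eq_self (hC : IsCollarFamily x C)
    (hs : ∀ n : ℤ, x n = 0 → 3 / 4 * (C n).width ≤ |s - n|) (y : ℝ) :
    profileParam x C s y = (hypAbscissa (x s) y, s) := by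
  rw [profileParam]
  split_ifs with hround
  · obtain ⟨hzero, hwidth⟩ := hround
    have hfar : 3 / 4 * (C (round s)).width ≤ |s - (C (round s)).center| := by
      rw [(hC _ hzero).1]
      exact hs _ hzero
    rw [Collar.foot_eq_self _ hfar, Collar.abscissa, Collar.cutoff_eq_one _ hfar, one_mul,
      hC.chart_eq hzero hwidth]
  · rfl

theorem eventually_profileParam_eq_collar (hC : IsCollarFamily x C) (hn : x n = 0)
    (hs : |s - n| < (C n).width) :
    ∀ᶠ u in 𝓝 s, ∀ y, profileParam x C u y = ((C n).abscissa u y, (C n).foot u y) := by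
  have hcont : Continuous fun u : ℝ => |u - n| := by fun_prop
  filter_upwards [hcont.continuousAt.eventually_lt continuousAt_const hs] with u hu
  exact hC.profileParam_eq_collar hn hu.le

theorem eventually_profileParam_eq_self (hC : IsCollarFamily x C)
    (hs : ∀ n : ℤ, x n = 0 → (C n).width ≤ |s - n|) :
    ∀ᶠ u in 𝓝 s, ∀ y, profileParam x C u y = (hypAbscissa (x u) y, u) := by
  have hcont : Continuous fun u : ℝ => |u - (round s : ℝ)| := by fun_prop
  have hround : x (round s) = 0 →
      ∀ᶠ u : ℝ in 𝓝 s, 3 / 4 * (C (round s)).width < |u - (round s : ℝ)| :=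
    fun hzero => continuousAt_const.eventually_lt hcont.continuousAt
      (by linarith [hs _ hzero, (C (round s)).width_pos])
  filter_upwards [Metric.ball_mem_nhds s (by norm_num : (0 : ℝ) < 1 / 6),
    Filter.eventually_imp_distrib_left.2 hround] with u hball hfar
  refine hC.profileParam_eq_self fun n hn => ?_
  by_contra! hlt
  have hle : |u - n| ≤ (C n).width := by linarith [(C n).width_pos]
  have heq : round s = n := by
    refine hC.eq_of_abs_sub_lt hn hle ?_
    calc |u - round s| ≤ |u - s| + |s - round s| := abs_sub_le _ _ _
      _ < 1 / 6 + 1 / 2 := add_lt_add_of_lt_of_le hball (abs_sub_round s)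
      _ = 2 / 3 := by norm_num
  subst heq
  exact absurd (hfar hn) hlt.not_gt

theorem abs_foot_sub_le (hC : IsCollarFamily x C) (hn : x n = 0) (s y : ℝ) :
    |(C n).foot s y - n| ≤ |s - n| := by
  simpa only [(hC n hn).1] using (C n).abs_foot_sub_center_le s y

theorem abs_profileParam_sub_lt_iff (hC : IsCollarFamily x C) (hn : x n = 0) (s y : ℝ) :
    |(profileParam x C s y).2 - n| < (C n).width ↔ |s - n| < (C n).width := by
  by_cases! hs : ∃ m : ℤ, x m = 0 ∧ |s - m| < (C m).width
  · obtain ⟨m, hm, hsm⟩ := hs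
    have hwidth := (hC m hm).2.1
    have hle := hC.abs_foot_sub_le hm s y
    rw [hC.profileParam_eq_collar hm hsm.le]
    constructor <;> intro hlt
    · obtain rfl := hC.eq_of_abs_sub_lt (m := m) hn hlt.le (by dsimp only; linarith)
      exact hsm
    · obtain rfl := hC.eq_of_abs_sub_lt (m := m) hn hlt.le (by linarith)
      exact hle.trans_lt hsm
  · rw [(hC.eventually_profileParam_eq_self hs).self_of_nhds y]

theorem apply_profileParam_snd (hxz : IsProfile x z) (hC : IsCollarFamily x C) (s y : ℝ) :
    x (profileParam x C s y).2 = hypRadius (profileParam x C s y).1 y := by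
  by_cases! hs : ∃ n : ℤ, x n = 0 ∧ |s - n| < (C n).width
  · obtain ⟨n, hn, hs⟩ := hs
    rw [hC.profileParam_eq_collar hn hs.le, ← Collar.chart_foot,
      hC.chart_eq hn ((hC.abs_foot_sub_le hn s y).trans hs.le)]
  · rw [(hC.eventually_profileParam_eq_self hs).self_of_nhds y,
      hypRadius_hypAbscissa (hxz.apply_ne_zero hs)]

theorem abs_profileParam_snd_sub_le (hC : IsCollarFamily x C) (s y : ℝ) :
    |(profileParam x C s y).2 - s| ≤ 1 := by
  by_cases! hs : ∃ n : ℤ, x n = 0 ∧ |s - n| < (C n).width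
  · obtain ⟨n, hn, hs⟩ := hs
    have hwidth := (hC n hn).2.1
    rw [hC.profileParam_eq_collar hn hs.le]
    calc |(C n).foot s y - s| ≤ |(C n).foot s y - n| + |n - s| := abs_sub_le _ _ _
      _ ≤ |s - n| + |s - n| := add_le_add (hC.abs_foot_sub_le hn s y) (abs_sub_comm _ _).le
      _ ≤ 1 := by linarith
  · simp [(hC.eventually_profileParam_eq_self hs).self_of_nhds y]

theorem profileParam_zero_right (hC : IsCollarFamily x C) (s : ℝ) :
    profileParam x C s 0 = (x s, s) := by
  by_cases! hs : ∃ n : ℤ, x n = 0 ∧ |s - n| < (C n).width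
  · obtain ⟨n, hn, hs⟩ := hs
    rw [hC.profileParam_eq_collar hn hs.le, Collar.foot, Collar.abscissa, mul_zero,
      hypAbscissa_zero_right, hypRadius_zero_right, Diffeomorph.symm_apply_apply,
      hC.chart_eq hn hs.le]
  · rw [(hC.eventually_profileParam_eq_self hs).self_of_nhds, hypAbscissa_zero_right]

theorem contDiff_profileParam (hxz : IsProfile x z) (hC : IsCollarFamily x C) :
    ContDiff ℝ ∞ fun p : ℝ × ℝ =>
      ((profileParam x C p.1 p.2).1, z (profileParam x C p.1 p.2).2) := by
  refine contDiff_iff_contDiffAt.2 fun p => ?_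
  have htendsto : Filter.Tendsto Prod.fst (𝓝 p) (𝓝 p.1) := continuous_fst.continuousAt
  by_cases! hs : ∃ n : ℤ, x n = 0 ∧ |p.1 - n| < (C n).width
  · obtain ⟨n, hn, hs⟩ := hs
    have hflat : IsFlatAt z (C n).center := by
      rw [(hC n hn).1]
      exact hxz.flat n hn
    refine ((C n).contDiff_abscissa.prodMk
      ((C n).contDiff_comp_foot hflat)).contDiffAt.congr_of_eventuallyEq ?_
    filter_upwards [htendsto.eventually (hC.eventually_profileParam_eq_collar hn hs)] with q hq
    rw [hq]
  · have habscissa : ContDiffAt ℝ ∞ (fun q : ℝ × ℝ => hypAbscissa (x q.1) q.2) p :=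
      (contDiffAt_hypAbscissa (p := (x p.1, p.2)) (hxz.apply_ne_zero hs)).comp p
        (f := fun q : ℝ × ℝ => (x q.1, q.2))
        ((hxz.contDiff_left.comp contDiff_fst).prodMk contDiff_snd).contDiffAt
    refine (habscissa.prodMk
      (hxz.contDiff_right.comp contDiff_fst).contDiffAt).congr_of_eventuallyEq ?_
    filter_upwards [htendsto.eventually (hC.eventually_profileParam_eq_self hs)] with q hq
    rw [hq]
    rfl

theorem contDiff_profileMap (hxz : IsProfile x z) (hC : IsCollarFamily x C) :
    ContDiff ℝ ∞ (profileMap x z C) := by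
  have hparam := (hC.contDiff_profileParam hxz).comp
    (f := fun q : Eucl (Fin 2) => (q 0, q 1)) (by fun_prop)
  refine contDiff_euclidean.2 fun i => ?_
  fin_cases i
  · exact hparam.fst
  · change ContDiff ℝ ∞ fun q : Eucl (Fin 2) => q 1
    fun_prop
  · exact hparam.snd

theorem injective_profileMap (hxz : IsProfile x z) (hC : IsCollarFamily x C) :
    Function.Injective (profileMap x z C) := by
  intro q q' h
  have h0 : (profileParam x C (q 0) (q 1)).1 = (profileParam x C (q' 0) (q' 1)).1 :=
    congrArg (· 0) h
  have h1 : q 1 = q' 1 := congrArg (· 1) h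
  have h2 : z (profileParam x C (q 0) (q 1)).2 = z (profileParam x C (q' 0) (q' 1)).2 :=
    congrArg (· 2) h
  rw [← h1] at h0 h2
  have hsnd := hxz.injective _ _ (by rw [hC.apply_profileParam_snd hxz, h0,
    ← hC.apply_profileParam_snd hxz]) h2
  have hnear (n : ℤ) (hn : x n = 0) : |q 0 - n| < (C n).width ↔ |q' 0 - n| < (C n).width := by
    rw [← hC.abs_profileParam_sub_lt_iff hn _ (q 1), hsnd, hC.abs_profileParam_sub_lt_iff hn]
  have hq0 : q 0 = q' 0 := by
    by_cases! hs : ∃ n : ℤ, x n = 0 ∧ |q 0 - n| < (C n).width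
    · obtain ⟨n, hn, hs⟩ := hs
      rw [hC.profileParam_eq_collar hn hs.le,
        hC.profileParam_eq_collar hn ((hnear n hn).1 hs).le] at h0
      exact (C n).injective_abscissa (q 1) h0
    · have hs' (n : ℤ) (hn : x n = 0) : (C n).width ≤ |q' 0 - n| :=
        not_lt.1 ((hnear n hn).not.1 (hs n hn).not_gt)
      rwa [(hC.eventually_profileParam_eq_self hs).self_of_nhds,
        (hC.eventually_profileParam_eq_self hs').self_of_nhds] at hsnd
  ext i
  fin_cases i
  exacts [hq0, h1]

theorem deriv_profileParam_ne_zero (hxz : IsProfile x z) (hC : IsCollarFamily x C) (s y : ℝ)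
    (hfst : deriv (fun u => (profileParam x C u y).1) s = 0) :
    deriv (fun u => z (profileParam x C u y).2) s ≠ 0 := by
  by_cases! hs : ∃ n : ℤ, x n = 0 ∧ |s - n| < (C n).width
  · obtain ⟨n, hn, hs⟩ := hs
    have heq : (fun u => (profileParam x C u y).1) =ᶠ[𝓝 s] fun u => (C n).abscissa u y :=
      (hC.eventually_profileParam_eq_collar hn hs).mono fun u hu => by simp only [hu y]
    exact absurd (heq.deriv_eq ▸ hfst) ((C n).deriv_abscissa_ne_zero s y)
  · have hne := hxz.apply_ne_zero hs
    have hfst_eq : (fun u => (profileParam x C u y).1) =ᶠ[𝓝 s] fun u => hypAbscissa (x u) y :=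
      (hC.eventually_profileParam_eq_self hs).mono fun u hu => by simp only [hu y]
    have hsnd_eq : (fun u => z (profileParam x C u y).2) =ᶠ[𝓝 s] z :=
      (hC.eventually_profileParam_eq_self hs).mono fun u hu => by simp only [hu y]
    have hx := (hxz.contDiff_left.differentiable (by simp) s).hasDerivAt
    have habscissa : DifferentiableAt ℝ (fun u => hypAbscissa (x u) y) s :=
      ((contDiffAt_hypAbscissa (n := ∞) (p := (x s, y)) hne).comp s (f := fun u => (x u, y))
        (hxz.contDiff_left.prodMk contDiff_const).contDiffAt).differentiableAt (by simp)
    have hsq : (fun u => hypAbscissa (x u) y ^ 2) =ᶠ[𝓝 s] fun u => x u ^ 2 + y ^ 2 :=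
      (hx.continuousAt.eventually_ne hne).mono fun u hu => sq_hypAbscissa hu y
    have hderiv := ((hx.fun_pow 2).add_const (y ^ 2)).unique
      ((habscissa.hasDerivAt.fun_pow 2).congr_of_eventuallyEq hsq.symm)
    rw [← hfst_eq.deriv_eq, hfst, mul_zero, mul_eq_zero] at hderiv
    rw [hsnd_eq.deriv_eq]
    exact hxz.regular s (hderiv.resolve_left (by simpa using hne))

theorem injective_fderiv_profileMap (hxz : IsProfile x z) (hC : IsCollarFamily x C)
    (q : Eucl (Fin 2)) : Function.Injective (fderiv ℝ (profileMap x z C) q) := by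
  refine (injective_iff_map_eq_zero _).2 fun v hv => ?_
  have hdiff := ((hC.contDiff_profileMap hxz).differentiable (by simp) q).hasFDerivAt
  have hcoord (i : Fin 3) := (EuclideanSpace.proj (𝕜 := ℝ) i).hasFDerivAt.comp q hdiff
  have hv1 : v 1 = 0 := by
    have hproj := (EuclideanSpace.proj (𝕜 := ℝ) (1 : Fin 2)).hasFDerivAt.unique (hcoord 1)
    simpa [hv] using DFunLike.congr_fun hproj v
  by_contra hne
  have hv_eq : v = v 0 • EuclideanSpace.single 0 1 := by
    ext i
    fin_cases i <;> simp [hv1]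
  have hsingle : fderiv ℝ (profileMap x z C) q (EuclideanSpace.single 0 1) = 0 := by
    rw [hv_eq, map_smul, smul_eq_zero] at hv
    exact hv.resolve_left fun h0 => hne (by rw [hv_eq, h0, zero_smul])
  have hline : HasDerivAt (fun u : ℝ => q + (u - q 0) • EuclideanSpace.single 0 (1 : ℝ))
      (EuclideanSpace.single 0 1) (q 0) := by
    simpa using (((hasDerivAt_id (q 0)).sub_const (q 0)).smul_const
      (EuclideanSpace.single 0 (1 : ℝ))).const_add q
  have hderiv (i : Fin 3) := (hcoord i).comp_hasDerivAt_of_eq (q 0) hline (by simp)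
  refine hC.deriv_profileParam_ne_zero hxz (q 0) (q 1) ?_ ?_
  · simpa [profileMap, Function.comp_def, hsingle] using (hderiv 0).deriv
  · simpa [profileMap, Function.comp_def, hsingle] using (hderiv 2).deriv

theorem isEmbedding_profileMap (hxz : IsProfile x z) (hC : IsCollarFamily x C) :
    Topology.IsEmbedding (profileMap x z C) := by
  have hcont := (hC.contDiff_profileMap hxz).continuous
  have hproper : IsProperMap (profileMap x z C) := by
    refine isProperMap_iff_isCompact_preimage.2 ⟨hcont, fun K hK =>
      Metric.isCompact_of_isClosed_isBounded (hK.isClosed.preimage hcont) ?_⟩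
    obtain ⟨M, hM⟩ := hK.isBounded.exists_norm_le
    obtain ⟨R, hR⟩ := (hxz.isBounded M).exists_norm_le
    refine isBounded_iff_forall_norm_le.2 ⟨R + 1 + M, fun q hq => ?_⟩
    have hcoord (i : Fin 3) : |profileMap x z C q i| ≤ M :=
      (PiLp.norm_apply_le _ i).trans (hM _ hq)
    have hfst : |(profileParam x C (q 0) (q 1)).1| ≤ M := hcoord 0
    have hx : |x (profileParam x C (q 0) (q 1)).2| ≤ M := by
      rw [hC.apply_profileParam_snd hxz]
      exact (abs_hypRadius_le _ _).trans hfst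
    have hq0 : |q 0| ≤ R + 1 := by
      have hfoot : |(profileParam x C (q 0) (q 1)).2| ≤ R := hR _ ⟨hx, hcoord 2⟩
      have hshift := abs_le.1 (hC.abs_profileParam_snd_sub_le (q 0) (q 1))
      rw [abs_le] at hfoot ⊢
      constructor <;> linarith
    have hq1 : |q 1| ≤ M := hcoord 1
    refine (sq_le_sq₀ (norm_nonneg q) (by linarith [abs_nonneg (q 0), abs_nonneg (q 1)])).1 ?_
    rw [EuclideanSpace.real_norm_sq_eq, Fin.sum_univ_two, ← sq_abs (q 0), ← sq_abs (q 1)]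
    nlinarith [abs_nonneg (q 0), abs_nonneg (q 1)]
  exact (Topology.IsClosedEmbedding.of_continuous_injective_isClosedMap hcont
    (hC.injective_profileMap hxz) hproper.isClosedMap).isEmbedding

theorem range_profileMap (hxz : IsProfile x z) (hC : IsCollarFamily x C) :
    Set.range (profileMap x z C) = profileSurface x z := by
  ext p
  constructor
  · rintro ⟨q, rfl⟩
    exact ⟨_, (hC.apply_profileParam_snd hxz (q 0) (q 1)).symm, rfl⟩
  · rintro ⟨u, hu, hzu⟩
    suffices ∃ s, profileParam x C s (p 1) = (p 0, u) by
      obtain ⟨s, hs⟩ := this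
      refine ⟨!₂[s, p 1], ?_⟩
      ext i
      fin_cases i
      · exact congrArg Prod.fst hs
      · rfl
      · exact (congrArg (fun v => z v.2) hs).trans hzu.symm
    by_cases! hfar : ∃ n : ℤ, x n = 0 ∧ |u - n| < (C n).width
    · obtain ⟨n, hn, hun⟩ := hfar
      obtain ⟨s, hs : (C n).abscissa s (p 1) = p 0⟩ :=
        (C n).surjective_abscissa (p 1) (p 0)
      have hfoot : (C n).foot s (p 1) = u := by
        rw [Collar.foot, hs, hu, ← hC.chart_eq hn hun.le, Diffeomorph.symm_apply_apply]
      have hsn : |s - n| ≤ (C n).width := by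
        by_contra! hlt
        have hself := (C n).foot_eq_self (s := s)
          (by rw [(hC n hn).1]; linarith [(C n).width_pos]) (p 1)
        rw [← hself, hfoot] at hlt
        exact hlt.not_gt hun
      exact ⟨s, by rw [hC.profileParam_eq_collar hn hsn, hs, hfoot]⟩
    · refine ⟨u, ?_⟩
      have hne := hxz.apply_ne_zero hfar
      rw [(hC.eventually_profileParam_eq_self hfar).self_of_nhds, ← hu,
        hypAbscissa_hypRadius (hu ▸ hne)]

theorem equilibria_eq_image (hC : IsCollarFamily x C) {Φ : Flow ℝ (Eucl (Fin 2))}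
    (hΦ : IsLinearizingEmbedding Φ hyperbolicMatrix (profileMap x z C)) :
    equilibria Φ = (fun s => !₂[s, 0]) '' {s | x s = 0} := by
  ext q
  rw [hΦ.mem_equilibria_iff, linearFlow_hyperbolicMatrix_eq_self_iff]
  change (profileParam x C (q 0) (q 1)).1 = 0 ∧ q 1 = 0 ↔ _
  constructor
  · rintro ⟨h0, h1⟩
    rw [h1, hC.profileParam_zero_right] at h0
    refine ⟨q 0, h0, ?_⟩
    ext i
    fin_cases i
    exacts [rfl, h1.symm]
  · rintro ⟨s, hs, rfl⟩
    exact ⟨(congrArg Prod.fst (hC.profileParam_zero_right s)).trans hs, rfl⟩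

end IsCollarFamily

theorem linearFlow_mem_profileSurface {x z : ℝ → ℝ} {p : Eucl (Fin 3)}
    (hp : p ∈ profileSurface x z) (t : ℝ) :
    linearFlow hyperbolicMatrix t p ∈ profileSurface x z := by
  obtain ⟨u, hu, hzu⟩ := hp
  exact ⟨u, (hypRadius_linearFlow t p).trans hu, by rw [← hzu, linearFlow_hyperbolicMatrix]; rfl⟩

theorem IsProfile.exists_isLinearizingEmbedding {x z : ℝ → ℝ} (hxz : IsProfile x z) :
    ∃ (Φ : Flow ℝ (Eucl (Fin 2))) (f : Eucl (Fin 2) → Eucl (Fin 3)),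
      IsSmoothFlow Φ ∧ HasIsolatedEquilibria Φ {s | x s = 0}.encard ∧
      IsLinearizingEmbedding Φ hyperbolicMatrix f ∧ Set.range f = profileSurface x z := by
  obtain ⟨C, hC⟩ := hxz.exists_isCollarFamily
  have hrange := hC.range_profileMap hxz
  obtain ⟨Φ, hΦ, hf⟩ := exists_flow_of_invariant_range (hC.contDiff_profileMap hxz)
    (hC.isEmbedding_profileMap hxz) (hC.injective_fderiv_profileMap hxz)
    (A := hyperbolicMatrix) fun t q =>
      hrange ▸ linearFlow_mem_profileSurface (hrange ▸ Set.mem_range_self q) t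
  have hcount : {s | x s = 0}.Countable :=
    (Set.countable_range ((↑) : ℤ → ℝ)).mono fun s hs =>
      (hxz.eq_intCast s hs).imp fun _ h => h.symm
  have hisol (s : ℝ) (hs : x s = 0) : ∃ U ∈ 𝓝 s, U ∩ {s | x s = 0} = {s} := by
    refine ⟨Metric.ball s 1, Metric.ball_mem_nhds s one_pos, ?_⟩
    refine Set.Subset.antisymm ?_ (Set.singleton_subset_iff.2 ⟨Metric.mem_ball_self one_pos, hs⟩)
    rintro t ⟨hts, ht⟩
    obtain ⟨m, rfl⟩ := hxz.eq_intCast t ht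
    obtain ⟨n, rfl⟩ := hxz.eq_intCast s hs
    rw [Metric.mem_ball, Real.dist_eq] at hts
    have hmn : m = n := sub_eq_zero.1 (Int.abs_lt_one_iff.1 (by exact_mod_cast hts))
    exact congrArg _ hmn
  exact ⟨Φ, profileMap x z C, hΦ, hasIsolatedEquilibria_of_image hcount hisol
    (r := fun q : Eucl (Fin 2) => q 0) (by fun_prop) (fun _ => rfl) (hC.equilibria_eq_image hf),
    hf, hrange⟩

/-! ### Continuing a snake beyond its end points -/

section Tail

open scoped Manifold

/-- To the left of `c`, the function `f` decreases diffeomorphically from `∞` to `0`. -/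
def IsTail (f : ℝ → ℝ) (c : ℝ) : Prop :=
  ∃ ξ : ℝ ≃ₘ[ℝ] ℝ, StrictAnti ξ ∧ ξ c = 0 ∧ Set.EqOn f ξ (Set.Iic c)

namespace IsTail

variable {f : ℝ → ℝ} {c : ℝ}

theorem pos (hf : IsTail f c) {s : ℝ} (hs : s < c) : 0 < f s := by
  obtain ⟨ξ, hanti, hc, heq⟩ := hf
  rw [heq hs.le, ← hc]
  exact hanti hs

theorem injOn (hf : IsTail f c) : Set.InjOn f (Set.Iic c) := by
  obtain ⟨ξ, -, -, heq⟩ := hf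
  exact heq.symm.injOn_iff.1 ξ.injective.injOn

theorem exists_eq (hf : IsTail f c) {v : ℝ} (hv : 0 ≤ v) : ∃ s ≤ c, f s = v := by
  obtain ⟨ξ, hanti, hc, heq⟩ := hf
  have hle : ξ.symm v ≤ c := hanti.le_iff_ge.1 (by rwa [hc, ξ.apply_symm_apply])
  exact ⟨ξ.symm v, hle, (heq hle).trans (ξ.apply_symm_apply v)⟩

theorem deriv_ne_zero (hf : IsTail f c) {s : ℝ} (hs : s < c) : deriv f s ≠ 0 := by
  obtain ⟨ξ, -, -, heq⟩ := hf
  rw [(heq.eventuallyEq_of_mem (Iic_mem_nhds hs)).deriv_eq]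
  exact deriv_diffeomorph_ne_zero ξ s

theorem isBounded (hf : IsTail f c) (M : ℝ) : Bornology.IsBounded {s | s ≤ c ∧ |f s| ≤ M} := by
  obtain ⟨ξ, -, -, heq⟩ := hf
  refine ((isCompact_closedBall (0 : ℝ) M).image ξ.symm.continuous).isBounded.subset ?_
  rintro s ⟨hs, hM⟩
  exact ⟨ξ s, by simpa [← heq hs] using hM, ξ.symm_apply_apply s⟩

theorem congr (hf : IsTail f c) {g : ℝ → ℝ} (hg : Set.EqOn g f (Set.Iic c)) : IsTail g c :=
  hf.imp fun _ h => ⟨h.1, h.2.1, hg.trans h.2.2⟩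

end IsTail

theorem contDiff_ite_le {f g : ℝ → ℝ} {c : ℝ} (hf : ContDiff ℝ ∞ f) (hg : ContDiff ℝ ∞ g)
    (hfg : f =ᶠ[𝓝 c] g) : ContDiff ℝ ∞ fun s => if s ≤ c then f s else g s := by
  refine contDiff_iff_contDiffAt.2 fun s => ?_
  rcases lt_trichotomy s c with hs | rfl | hs
  · refine hf.contDiffAt.congr_of_eventuallyEq ?_
    filter_upwards [Iio_mem_nhds hs] with u hu
    rw [if_pos (Set.mem_Iio.1 hu).le]
  · refine hg.contDiffAt.congr_of_eventuallyEq ?_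
    filter_upwards [hfg] with u hu
    rw [hu, ite_self]
  · refine hg.contDiffAt.congr_of_eventuallyEq ?_
    filter_upwards [Ioi_mem_nhds hs] with u hu
    rw [if_neg (Set.mem_Ioi.1 hu).not_ge]

theorem exists_contDiff_isTail {f : ℝ → ℝ} {c : ℝ} (hf : ContDiff ℝ ∞ f) (hzero : f c = 0)
    (hderiv : deriv f c ≠ 0) (hneg : ∀ᶠ s in 𝓝[>] c, f s < 0) :
    ∃ g, ContDiff ℝ ∞ g ∧ IsTail g c ∧ ∀ s ≥ c, g =ᶠ[𝓝 s] f := by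
  obtain ⟨ξ, hξ⟩ := exists_diffeomorph_eventuallyEq hf hderiv
  have hξc : ξ c = 0 := hξ.self_of_nhds.trans hzero
  have hanti : StrictAnti ξ := by
    refine (ξ.continuous.strictMono_of_inj ξ.injective).resolve_left fun hmono => ?_
    obtain ⟨s, hs, hξs, hcs⟩ :=
      (hneg.and ((hξ.filter_mono nhdsWithin_le_nhds).and self_mem_nhdsWithin)).exists
    have hlt := hmono hcs
    rw [hξc, hξs] at hlt
    exact hlt.not_gt hs
  refine ⟨_, contDiff_ite_le ξ.contDiff hf hξ, ⟨ξ, hanti, hξc, fun s hs => if_pos hs⟩, ?_⟩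
  intro s hs
  rcases hs.le.eq_or_lt with rfl | hlt
  · filter_upwards [hξ] with u hu
    rw [hu, ite_self]
  · filter_upwards [Ioi_mem_nhds hlt] with u hu
    rw [if_neg (Set.mem_Ioi.1 hu).not_ge]

end Tail

/-- The functions `x` and `z` continue the coordinates `x` and `z` of `γ` from `[0, ℓ - 1]` to the
line, such that `z` is constant and `x` runs to infinity, away from the arc, beyond the end points.
To be a tail in the sense of `IsTail`, the right end is reflected in time and, if it runs to `-∞`,
in sign. -/
structure IsContinuation (ℓ : ℕ∞) (γ : ℝ → Eucl (Fin 3)) (x z : ℝ → ℝ) : Prop where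
  contDiff_left : ContDiff ℝ ∞ x
  contDiff_right : ContDiff ℝ ∞ z
  eventuallyEq_left : ∀ s ∈ paramSet ℓ, x =ᶠ[𝓝 s] fun s => γ s 0
  eqOn_right : ∀ s ∈ paramSet ℓ, z s = γ s 2
  flat : ∀ j : ℕ, (j : ℕ∞) < ℓ → IsFlatAt z j
  left_tail : IsTail x 0
  left_height : ∀ s ≤ 0, z s = 0
  right_tail : ∀ j : ℕ, ((j + 1 : ℕ) : ℕ∞) = ℓ →
    IsTail (fun s => (-1) ^ (j + 1) * x (-s)) (-j)
  right_height : ∀ j : ℕ, ((j + 1 : ℕ) : ℕ∞) = ℓ → ∀ s ≥ (j : ℝ), z s = j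

section Snake

variable {ℓ : ℕ∞} {γ : ℝ → Eucl (Fin 3)}

theorem natCast_mem_paramSet {j : ℕ} (hj : (j : ℕ∞) < ℓ) : (j : ℝ) ∈ paramSet ℓ :=
  ⟨j.cast_nonneg, j, hj, le_rfl⟩

theorem Icc_subset_paramSet {j : ℕ} (hj : ((j + 1 : ℕ) : ℕ∞) < ℓ) :
    Set.Icc (j : ℝ) (j + 1) ⊆ paramSet ℓ := fun _ hs =>
  ⟨j.cast_nonneg.trans hs.1, j + 1, hj, by exact_mod_cast hs.2⟩

theorem uniqueDiffOn_paramSet (hℓ : 2 ≤ ℓ) : UniqueDiffOn ℝ (paramSet ℓ) := by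
  refine uniqueDiffOn_convex (Set.OrdConnected.convex ⟨?_⟩) ⟨1 / 2, ?_⟩
  · rintro s hs t ⟨-, j, hj, ht⟩ u hu
    exact ⟨hs.1.trans hu.1, j, hj, hu.2.trans ht⟩
  · have hIcc := Icc_subset_paramSet (ℓ := ℓ) (j := 0) (lt_of_lt_of_le (by norm_num) hℓ)
    exact mem_interior_iff_mem_nhds.2
      (Filter.mem_of_superset (Icc_mem_nhds (by norm_num) (by norm_num)) hIcc)

theorem hasDerivAt_coord {s : ℝ} (hγ : DifferentiableAt ℝ γ s) (i : Fin 3) :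
    HasDerivAt (fun s => γ s i) (deriv γ s i) s :=
  (EuclideanSpace.proj (𝕜 := ℝ) i).hasFDerivAt.comp_hasDerivAt _ hγ.hasDerivAt

namespace IsSnake

theorem contDiff_coord (hγ : IsSnake ℓ γ) (i : Fin 3) : ContDiff ℝ ∞ fun s => γ s i :=
  contDiff_euclidean.1 hγ.smooth i

theorem isFlatAt (hγ : IsSnake ℓ γ) {j : ℕ} (hj : (j : ℕ∞) < ℓ) :
    IsFlatAt (fun s => γ s 2) j :=
  ⟨hγ.contDiff_coord 2, hγ.flat j hj⟩

theorem deriv_joint_ne_zero (hγ : IsSnake ℓ γ) (hℓ : 2 ≤ ℓ) {j : ℕ} (hj : (j : ℕ∞) < ℓ) :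
    deriv (fun s => γ s 0) j ≠ 0 := by
  intro hx
  have hmem := natCast_mem_paramSet hj
  have hcoord := hasDerivAt_coord (hγ.smooth.differentiable (by simp) j)
  have hy : deriv γ j 1 = 0 :=
    (uniqueDiffOn_paramSet hℓ _ hmem).eq_deriv _ (hcoord 1).hasDerivWithinAt
      ((hasDerivWithinAt_const _ _ (0 : ℝ)).congr hγ.planar (hγ.planar _ hmem))
  refine hγ.regular j hmem ?_
  ext i
  fin_cases i
  exacts [(hcoord 0).deriv.symm.trans hx, hy,
    (hcoord 2).deriv.symm.trans (hγ.isFlatAt hj).deriv_eq_zero]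

end IsSnake

end Snake

theorem exists_contDiff_isTail_comp_neg {f : ℝ → ℝ} {c ε : ℝ} (hf : ContDiff ℝ ∞ f)
    (hzero : f c = 0) (hderiv : deriv f c ≠ 0) (hε : ε * ε = 1)
    (hneg : ∀ᶠ s in 𝓝[<] c, ε * f s < 0) :
    ∃ g, ContDiff ℝ ∞ g ∧ IsTail (fun s => ε * g (-s)) (-c) ∧ ∀ s ≤ c, g =ᶠ[𝓝 s] f := by
  have hε0 : ε ≠ 0 := by rintro rfl; simp at hε
  obtain ⟨g, hg, htail, heq⟩ :=
    exists_contDiff_isTail (f := fun s => ε * f (-s)) (c := -c) (by fun_prop)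
      (by simp [hzero]) (by simp [deriv_comp_neg, hderiv, hε0])
      (tendsto_neg_nhdsGT_neg.eventually hneg)
  refine ⟨fun s => ε * g (-s), by fun_prop, ?_, fun s hs => ?_⟩
  · simpa only [neg_neg, ← mul_assoc, hε, one_mul] using htail
  · filter_upwards [(continuous_neg.tendsto s).eventually (heq (-s) (neg_le_neg hs))] with u hu
    rw [hu, neg_neg, ← mul_assoc, hε, one_mul]

namespace IsSnake

variable {ℓ : ℕ∞} {γ : ℝ → Eucl (Fin 3)}

theorem exists_isTail_zero (hγ : IsSnake ℓ γ) (hℓ : 2 ≤ ℓ) :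
    ∃ x, ContDiff ℝ ∞ x ∧ IsTail x 0 ∧ ∀ s ≥ 0, x =ᶠ[𝓝 s] fun s => γ s 0 := by
  have hone : ((0 + 1 : ℕ) : ℕ∞) < ℓ := lt_of_lt_of_le (by norm_num) hℓ
  have hpos : ((0 : ℕ) : ℕ∞) < ℓ := lt_of_lt_of_le (by norm_num) hℓ
  refine exists_contDiff_isTail (hγ.contDiff_coord 0) (by simpa using (hγ.joint 0 hpos).1)
    (by simpa using hγ.deriv_joint_ne_zero hℓ hpos) ?_
  filter_upwards [Ioo_mem_nhdsGT zero_lt_one] with s hs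
  simpa using hγ.side 0 hone s (by simpa using hs)

theorem exists_isTail_last {J : ℕ} (hγ : IsSnake ((J + 1 + 1 : ℕ) : ℕ∞) γ) {x₀ : ℝ → ℝ}
    (hx₀ : ContDiff ℝ ∞ x₀) (hxγ : ∀ s ≥ 0, x₀ =ᶠ[𝓝 s] fun s => γ s 0) :
    ∃ x, ContDiff ℝ ∞ x ∧ IsTail (fun s => (-1) ^ (J + 1 + 1) * x (-s)) (-(J + 1 : ℕ)) ∧
      ∀ s ≤ ((J + 1 : ℕ) : ℝ), x =ᶠ[𝓝 s] x₀ := by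
  have hlast : ((J + 1 : ℕ) : ℕ∞) < ((J + 1 + 1 : ℕ) : ℕ∞) := by exact_mod_cast (J + 1).lt_succ_self
  have hJ := hxγ (J + 1 : ℕ) (Nat.cast_nonneg _)
  refine exists_contDiff_isTail_comp_neg hx₀ (hJ.self_of_nhds.trans (hγ.joint _ hlast).1) ?_
    (by rw [← mul_pow]; norm_num) ?_
  · rw [hJ.deriv_eq]
    exact hγ.deriv_joint_ne_zero (by exact_mod_cast Nat.le_add_left 2 J) hlast
  · filter_upwards [Ioo_mem_nhdsLT (show (J : ℝ) < (J + 1 : ℕ) by simp)] with s hs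
    have hside := hγ.side J hlast s (by exact_mod_cast hs)
    rw [(hxγ s (J.cast_nonneg.trans hs.1.le)).self_of_nhds, pow_succ]
    linarith

theorem isFlatAt_comp_max (hγ : IsSnake ℓ γ) {j : ℕ} (hj : (j : ℕ∞) < ℓ) :
    IsFlatAt (fun s => γ (max s 0) 2) j :=
  IsFlatAt.comp_max (by simpa using hγ.isFlatAt (j := 0) (by simpa using bot_lt_of_lt hj))
    (hγ.isFlatAt hj)
    j.cast_nonneg

theorem exists_isContinuation_top (hγ : IsSnake ⊤ γ) : ∃ x z, IsContinuation ⊤ γ x z := by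
  have hpos : ((0 : ℕ) : ℕ∞) < ⊤ := ENat.natCast_lt_top 0
  obtain ⟨x, hx, hleft, hxγ⟩ := hγ.exists_isTail_zero le_top
  refine ⟨x, fun s => γ (max s 0) 2, hx, (hγ.isFlatAt_comp_max hpos).contDiff,
    fun s hs => hxγ s hs.1, fun s hs => by simp only [max_eq_left hs.1],
    fun j => hγ.isFlatAt_comp_max, hleft, fun s hs => ?_,
    fun j hj => absurd hj (ENat.natCast_ne_top _), fun j hj => absurd hj (ENat.natCast_ne_top _)⟩
  simpa [max_eq_right hs] using (hγ.joint 0 hpos).2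

theorem exists_isContinuation_natCast {J : ℕ} (hγ : IsSnake ((J + 1 + 1 : ℕ) : ℕ∞) γ) :
    ∃ x z, IsContinuation ((J + 1 + 1 : ℕ) : ℕ∞) γ x z := by
  obtain ⟨x₀, hx₀, hleft, hxγ⟩ := hγ.exists_isTail_zero (by exact_mod_cast Nat.le_add_left 2 J)
  obtain ⟨x, hx, hright, hxx₀⟩ := hγ.exists_isTail_last hx₀ hxγ
  have hpos : ((0 : ℕ) : ℕ∞) < ((J + 1 + 1 : ℕ) : ℕ∞) := by exact_mod_cast (J + 1).succ_pos
  have hlast : ((J + 1 : ℕ) : ℕ∞) < ((J + 1 + 1 : ℕ) : ℕ∞) := by exact_mod_cast (J + 1).lt_succ_self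
  have hle {j : ℕ} (hj : (j : ℕ∞) < ((J + 1 + 1 : ℕ) : ℕ∞)) : (j : ℝ) ≤ (J + 1 : ℕ) := by
    exact_mod_cast Nat.lt_succ_iff.1 (by exact_mod_cast hj)
  have hflat (j : ℕ) (hj : (j : ℕ∞) < ((J + 1 + 1 : ℕ) : ℕ∞)) :
      IsFlatAt (fun s => γ (max (min s (J + 1 : ℕ)) 0) 2) j :=
    (hγ.isFlatAt_comp_max hlast).comp_min (hγ.isFlatAt_comp_max hj) (hle hj)
  have heq {j : ℕ} (hj : ((j + 1 : ℕ) : ℕ∞) = ((J + 1 + 1 : ℕ) : ℕ∞)) : j = J + 1 :=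
    Nat.succ_injective (by exact_mod_cast hj)
  refine ⟨x, fun s => γ (max (min s (J + 1 : ℕ)) 0) 2, hx, (hflat 0 hpos).contDiff, ?_, ?_,
    hflat, hleft.congr fun s hs => ?_, fun s hs => ?_, fun j hj => heq hj ▸ hright,
    fun j hj s hs => ?_⟩
  · rintro s ⟨hs, j, hj, hsj⟩
    exact (hxx₀ s (hsj.trans (hle hj))).trans (hxγ s hs)
  · rintro s ⟨hs, j, hj, hsj⟩
    simp only [min_eq_left (hsj.trans (hle hj)), max_eq_left hs]
  · exact (hxx₀ s ((Set.mem_Iic.1 hs).trans (Nat.cast_nonneg _))).self_of_nhds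
  · simp only [min_eq_left (hs.trans (Nat.cast_nonneg _)), max_eq_right hs]
    simpa using (hγ.joint 0 hpos).2
  · obtain rfl := heq hj
    simp only [min_eq_right hs, max_eq_left (Nat.cast_nonneg _), (hγ.joint _ hlast).2]

theorem exists_isContinuation (hγ : IsSnake ℓ γ) (hℓ : 2 ≤ ℓ) :
    ∃ x z, IsContinuation ℓ γ x z := by
  cases ℓ with
  | top => exact hγ.exists_isContinuation_top
  | coe N =>
    obtain ⟨J, rfl⟩ : ∃ J, N = J + 1 + 1 := Nat.exists_eq_add_of_le' (by exact_mod_cast hℓ)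
    exact hγ.exists_isContinuation_natCast

end IsSnake

theorem paramSet_cases {ℓ : ℕ∞} (hℓ : 0 < ℓ) (s : ℝ) :
    s < 0 ∨ (∃ j : ℕ, (j : ℕ∞) < ℓ ∧ s = j) ∨
      (∃ j : ℕ, ((j + 1 : ℕ) : ℕ∞) < ℓ ∧ s ∈ Set.Ioo (j : ℝ) (j + 1)) ∨
      ∃ j : ℕ, ((j + 1 : ℕ) : ℕ∞) = ℓ ∧ (j : ℝ) < s := by
  rcases lt_or_ge s 0 with hs | hs
  · exact .inl hs
  rcases lt_or_ge ((⌊s⌋₊ + 1 : ℕ) : ℕ∞) ℓ with hj | hj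
  · have hlt : (⌊s⌋₊ : ℕ∞) < ℓ := lt_of_le_of_lt (by simp) hj
    rcases (Nat.floor_le hs).eq_or_lt with heq | hfloor
    · exact .inr (.inl ⟨_, hlt, heq.symm⟩)
    · exact .inr (.inr (.inl ⟨_, hj, hfloor, Nat.lt_floor_add_one s⟩))
  · lift ℓ to ℕ using ne_top_of_le_ne_top (ENat.natCast_ne_top _) hj
    obtain ⟨J, rfl⟩ := Nat.exists_eq_succ_of_ne_zero (n := ℓ) (by rintro rfl; simp at hℓ)
    have hJ : (J : ℝ) ≤ s :=
      le_trans (by exact_mod_cast Nat.le_of_succ_le_succ (by exact_mod_cast hj)) (Nat.floor_le hs)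
    rcases hJ.eq_or_lt with heq | hJs
    · exact .inr (.inl ⟨J, by exact_mod_cast J.lt_succ_self, heq.symm⟩)
    · exact .inr (.inr (.inr ⟨J, rfl, hJs⟩))

namespace IsContinuation

variable {ℓ : ℕ∞} {γ : ℝ → Eucl (Fin 3)} {x z : ℝ → ℝ} {j : ℕ} {s : ℝ}

theorem left_joint (h : IsContinuation ℓ γ x z) (hγ : IsSnake ℓ γ) (hj : (j : ℕ∞) < ℓ) :
    x j = 0 :=
  (h.eventuallyEq_left j (natCast_mem_paramSet hj)).self_of_nhds.trans (hγ.joint j hj).1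

theorem right_joint (h : IsContinuation ℓ γ x z) (hγ : IsSnake ℓ γ) (hj : (j : ℕ∞) < ℓ) :
    z j = j :=
  (h.eqOn_right j (natCast_mem_paramSet hj)).trans (hγ.joint j hj).2

theorem left_pos (h : IsContinuation ℓ γ x z) (hγ : IsSnake ℓ γ)
    (hj : ((j + 1 : ℕ) : ℕ∞) < ℓ) (hs : s ∈ Set.Ioo (j : ℝ) (j + 1)) :
    0 < (-1) ^ (j + 1) * x s := by
  rw [(h.eventuallyEq_left s
    (Icc_subset_paramSet hj (Set.Ioo_subset_Icc_self hs))).self_of_nhds]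
  exact hγ.side j hj s hs

theorem left_pos_of_eq (h : IsContinuation ℓ γ x z) (hj : ((j + 1 : ℕ) : ℕ∞) = ℓ)
    (hs : (j : ℝ) < s) : 0 < (-1) ^ (j + 1) * x s := by
  simpa only [neg_neg] using (h.right_tail j hj).pos (neg_lt_neg hs)

theorem left_eq_zero_iff (h : IsContinuation ℓ γ x z) (hγ : IsSnake ℓ γ) (hℓ : 0 < ℓ) :
    x s = 0 ↔ ∃ j : ℕ, (j : ℕ∞) < ℓ ∧ s = j := by
  refine ⟨fun hzero => ?_, ?_⟩
  · rcases paramSet_cases hℓ s with hs | hs | ⟨j, hj, hs⟩ | ⟨j, hj, hs⟩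
    · exact absurd hzero (h.left_tail.pos hs).ne'
    · exact hs
    · exact absurd hzero (right_ne_zero_of_mul (h.left_pos hγ hj hs).ne')
    · exact absurd hzero (right_ne_zero_of_mul (h.left_pos_of_eq hj hs).ne')
  · rintro ⟨j, hj, rfl⟩
    exact h.left_joint hγ hj

theorem deriv_right_pos (h : IsContinuation ℓ γ x z) (hγ : IsSnake ℓ γ)
    (hj : ((j + 1 : ℕ) : ℕ∞) < ℓ) (hs : s ∈ Set.Ioo (j : ℝ) (j + 1)) : 0 < deriv z s := by
  have heq : z =ᶠ[𝓝 s] fun s => γ s 2 := by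
    filter_upwards [Ioo_mem_nhds hs.1 hs.2] with u hu
    exact h.eqOn_right u (Icc_subset_paramSet hj (Set.Ioo_subset_Icc_self hu))
  rw [heq.deriv_eq]
  exact hγ.rising j hj s hs

theorem monotone_right (h : IsContinuation ℓ γ x z) (hγ : IsSnake ℓ γ) (hℓ : 0 < ℓ) :
    Monotone z := by
  refine monotone_of_deriv_nonneg (h.contDiff_right.differentiable (by simp)) fun s => ?_
  rcases paramSet_cases hℓ s with hs | ⟨j, hj, rfl⟩ | ⟨j, hj, hs⟩ | ⟨j, hj, hs⟩
  · have heq : z =ᶠ[𝓝 s] fun _ => 0 := by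
      filter_upwards [Iio_mem_nhds hs] with u hu using h.left_height u (Set.mem_Iio.1 hu).le
    simp [heq.deriv_eq]
  · exact (h.flat j hj).deriv_eq_zero.ge
  · exact (h.deriv_right_pos hγ hj hs).le
  · have heq : z =ᶠ[𝓝 s] fun _ => (j : ℝ) := by
      filter_upwards [Ioi_mem_nhds hs] with u hu using h.right_height j hj u (Set.mem_Ioi.1 hu).le
    simp [heq.deriv_eq]

theorem right_lt (h : IsContinuation ℓ γ x z) (hγ : IsSnake ℓ γ)
    (hj : ((j + 1 : ℕ) : ℕ∞) < ℓ) (hs : s ∈ Set.Ico (j : ℝ) (j + 1)) {t : ℝ} (hst : s < t) :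
    z s < z t := by
  have hstrict : StrictMonoOn z (Set.Icc (j : ℝ) (j + 1)) :=
    strictMonoOn_of_deriv_pos (convex_Icc _ _) h.contDiff_right.continuous.continuousOn
      fun u hu => h.deriv_right_pos hγ hj (by simpa using hu)
  have hmin : s < min t (j + 1) := lt_min hst hs.2
  calc z s < z (min t (j + 1)) :=
        hstrict ⟨hs.1, hs.2.le⟩ ⟨hs.1.trans hmin.le, min_le_right _ _⟩ hmin
    _ ≤ z t := h.monotone_right hγ (bot_lt_of_lt hj) (min_le_left _ _)

theorem left_ne_of_eq (h : IsContinuation ℓ γ x z) (hj : ((j + 1 : ℕ) : ℕ∞) = ℓ)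
    (hs : (j : ℝ) ≤ s) {t : ℝ} (hst : s < t) : x s ≠ x t := fun heq =>
  hst.ne (neg_injective ((h.right_tail j hj).injOn (neg_le_neg hs)
    (neg_le_neg (hs.trans hst.le)) (by simp only [neg_neg, heq])))

theorem ne_of_lt (h : IsContinuation ℓ γ x z) (hγ : IsSnake ℓ γ) (hℓ : 2 ≤ ℓ) {t : ℝ}
    (hst : s < t) (hx : x s = x t) : z s ≠ z t := by
  rcases paramSet_cases (two_pos.trans_le hℓ) s with hs | ⟨j, hj, rfl⟩ | ⟨j, hj, hs⟩ | ⟨j, hj, hs⟩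
  · rcases le_or_gt t 0 with ht | ht
    · exact absurd (h.left_tail.injOn hs.le ht hx) hst.ne
    · have hlt := h.right_lt hγ (j := 0) (s := 0) (lt_of_lt_of_le (by norm_num) hℓ) (by simp) ht
      exact ((h.monotone_right hγ (two_pos.trans_le hℓ) hs.le).trans_lt hlt).ne
  · rcases (Order.add_one_le_of_lt hj).lt_or_eq with hlt | heq
    · exact (h.right_lt hγ (by exact_mod_cast hlt) (by simp) hst).ne
    · exact absurd hx (h.left_ne_of_eq (by exact_mod_cast heq) le_rfl hst)
  · exact (h.right_lt hγ hj (Set.Ioo_subset_Ico_self hs) hst).ne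
  · exact absurd hx (h.left_ne_of_eq hj hs.le hst)

theorem isBounded (h : IsContinuation ℓ γ x z) (hγ : IsSnake ℓ γ) (hℓ : 0 < ℓ) (M : ℝ) :
    Bornology.IsBounded {s | |x s| ≤ M ∧ |z s| ≤ M} := by
  have hright : Bornology.IsBounded
      {s | ∃ j : ℕ, ((j + 1 : ℕ) : ℕ∞) = ℓ ∧ (j : ℝ) < s ∧ |x s| ≤ M} := by
    by_cases! hfin : ∃ j : ℕ, ((j + 1 : ℕ) : ℕ∞) = ℓ
    · obtain ⟨J, rfl⟩ := hfin
      refine ((h.right_tail J rfl).isBounded M).neg.subset ?_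
      rintro s ⟨j, hj, hs, hM⟩
      obtain rfl : j = J := Nat.succ_injective (by exact_mod_cast hj)
      exact ⟨neg_le_neg hs.le, by simpa [abs_mul] using hM⟩
    · exact Bornology.isBounded_empty.subset fun s ⟨j, hj, _⟩ => hfin j hj
  refine ((h.left_tail.isBounded M).union
    ((Metric.isBounded_Icc (0 : ℝ) (M + 1)).union hright)).subset ?_
  rintro s ⟨hx, hz⟩
  rcases paramSet_cases hℓ s with hs | ⟨j, hj, rfl⟩ | ⟨j, hj, hs⟩ | ⟨j, hj, hs⟩
  · exact .inl ⟨hs.le, hx⟩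
  · rw [h.right_joint hγ hj, Nat.abs_cast] at hz
    exact .inr (.inl ⟨j.cast_nonneg, by linarith⟩)
  · have hle : z j ≤ z s := h.monotone_right hγ hℓ hs.1.le
    rw [h.right_joint hγ (lt_of_le_of_lt (by simp) hj)] at hle
    exact .inr (.inl ⟨j.cast_nonneg.trans hs.1.le, by linarith [hs.2, (abs_le.1 hz).2]⟩)
  · exact .inr (.inr ⟨j, hj, hs, hx⟩)

theorem deriv_right_ne_zero (h : IsContinuation ℓ γ x z) (hγ : IsSnake ℓ γ) (hℓ : 2 ≤ ℓ)
    (hx : deriv x s = 0) : deriv z s ≠ 0 := by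
  rcases paramSet_cases (two_pos.trans_le hℓ) s with hs | ⟨j, hj, rfl⟩ | ⟨j, hj, hs⟩ | ⟨j, hj, hs⟩
  · exact absurd hx (h.left_tail.deriv_ne_zero hs)
  · rw [(h.eventuallyEq_left j (natCast_mem_paramSet hj)).deriv_eq] at hx
    exact absurd hx (hγ.deriv_joint_ne_zero hℓ hj)
  · exact (h.deriv_right_pos hγ hj hs).ne'
  · refine absurd ?_ ((h.right_tail j hj).deriv_ne_zero (neg_lt_neg hs))
    simp [deriv_comp_neg, hx]

theorem isProfile (h : IsContinuation ℓ γ x z) (hγ : IsSnake ℓ γ) (hℓ : 2 ≤ ℓ) :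
    IsProfile x z where
  contDiff_left := h.contDiff_left
  contDiff_right := h.contDiff_right
  injective s t hx hz := by
    rcases lt_trichotomy s t with hst | rfl | hts
    · exact absurd hz (h.ne_of_lt hγ hℓ hst hx)
    · rfl
    · exact absurd hz.symm (h.ne_of_lt hγ hℓ hts hx.symm)
  regular s := h.deriv_right_ne_zero hγ hℓ
  eq_intCast s hs := by
    obtain ⟨j, -, rfl⟩ := (h.left_eq_zero_iff hγ (two_pos.trans_le hℓ)).1 hs
    exact ⟨j, by simp⟩
  flat s hs := by
    obtain ⟨j, hj, rfl⟩ := (h.left_eq_zero_iff hγ (two_pos.trans_le hℓ)).1 hs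
    exact h.flat j hj
  isBounded := h.isBounded hγ (two_pos.trans_le hℓ)

theorem encard_setOf_left_eq_zero (h : IsContinuation ℓ γ x z) (hγ : IsSnake ℓ γ) (hℓ : 0 < ℓ) :
    {s | x s = 0}.encard = ℓ := by
  have himage : {s | x s = 0} = Nat.cast '' {j : ℕ | (j : ℕ∞) < ℓ} := by
    ext s
    simp [h.left_eq_zero_iff hγ hℓ, eq_comm]
  rw [himage, Nat.cast_injective.encard_image]
  cases ℓ with
  | top => simp
  | coe N =>
    have hrange : {j : ℕ | (j : ℕ∞) < N} = Finset.range N := by ext; simp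
    rw [hrange, Set.encard_coe_eq_coe_finsetCard, Finset.card_range]

end IsContinuation

theorem mem_quadrant_iff {σ : ℝ} (hσ : σ * σ = 1) {p : Eucl (Fin 3)} :
    p ∈ quadrant σ ↔ 0 < σ * hypRadius (p 0) (p 1) := by
  rcases mul_self_eq_one_iff.1 hσ with rfl | rfl
  · simp only [quadrant, Set.mem_ofPred_eq, one_mul, hypRadius_pos_iff]
  · simp only [quadrant, Set.mem_ofPred_eq, neg_one_mul, Left.neg_pos_iff, hypRadius_neg_iff]

theorem mem_cutPlane_removedSides_iff {ℓ : ℕ∞} {j : ℕ} {p : Eucl (Fin 3)} :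
    p ∈ cutPlane j (removedSides ℓ j) ↔ p 2 = j ∧
      (1 ≤ j → (-1) ^ j * hypRadius (p 0) (p 1) ≤ 0) ∧
      (((j + 1 : ℕ) : ℕ∞) < ℓ → (-1) ^ (j + 1) * hypRadius (p 0) (p 1) ≤ 0) := by
  have hmem (n : ℕ) : p ∈ quadrant ((-1) ^ n) ↔ 0 < (-1) ^ n * hypRadius (p 0) (p 1) :=
    mem_quadrant_iff (by rw [← mul_pow]; norm_num)
  simp only [cutPlane, removedSides, Set.mem_sdiff, Set.mem_iUnion, Set.mem_ofPred_eq, exists_prop,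
    ← not_lt, ← hmem]
  grind

namespace IsContinuation

variable {ℓ : ℕ∞} {γ : ℝ → Eucl (Fin 3)} {x z : ℝ → ℝ}

theorem mem_profileSurface_of_mem_cutPlane (h : IsContinuation ℓ γ x z) (hγ : IsSnake ℓ γ) {j : ℕ}
    (hj : (j : ℕ∞) < ℓ) {p : Eucl (Fin 3)} (hp : p ∈ cutPlane j (removedSides ℓ j)) :
    p ∈ profileSurface x z := by
  obtain ⟨hz, hbelow, habove⟩ := mem_cutPlane_removedSides_iff.1 hp
  set R := hypRadius (p 0) (p 1)
  rcases lt_trichotomy ((-1) ^ j * R) 0 with hR | hR | hR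
  · have hlast : ((j + 1 : ℕ) : ℕ∞) = ℓ := by
      refine (Order.add_one_le_of_lt hj).eq_of_not_lt fun hlt => ?_
      have := habove hlt
      rw [pow_succ] at this
      linarith
    obtain ⟨u, hu, hxu⟩ := (h.right_tail j hlast).exists_eq (v := (-1) ^ (j + 1) * R)
      (by rw [pow_succ]; linarith)
    exact ⟨-u, (mul_left_cancel₀ (pow_ne_zero _ (by norm_num)) hxu).symm,
      hz.trans (h.right_height j hlast _ (le_neg_of_le_neg hu)).symm⟩
  · have hR0 : R = 0 := (mul_eq_zero.1 hR).resolve_left (pow_ne_zero _ (by norm_num))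
    exact ⟨j, hR0.trans (h.left_joint hγ hj).symm, hz.trans (h.right_joint hγ hj).symm⟩
  · obtain rfl : j = 0 := by
      by_contra hj0
      exact (hbelow (Nat.one_le_iff_ne_zero.2 hj0)).not_gt hR
    obtain ⟨u, hu, hxu⟩ := h.left_tail.exists_eq (v := R) (by simpa using hR.le)
    exact ⟨u, hxu.symm, hz.trans (by simp [h.left_height u hu])⟩

theorem stackedSurface_subset (h : IsContinuation ℓ γ x z) (hγ : IsSnake ℓ γ) :
    stackedSurface ℓ γ ⊆ profileSurface x z := by
  rintro p (hp | ⟨_, ⟨s, hs, rfl⟩, t, rfl⟩)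
  · obtain ⟨j, hj, hp⟩ := Set.mem_iUnion₂.1 hp
    exact h.mem_profileSurface_of_mem_cutPlane hγ hj hp
  · refine linearFlow_mem_profileSurface ⟨s, ?_, (h.eqOn_right s hs).symm⟩ t
    rw [hγ.planar s hs, hypRadius_zero_right, (h.eventuallyEq_left s hs).self_of_nhds]

theorem profileSurface_subset (h : IsContinuation ℓ γ x z) (hγ : IsSnake ℓ γ) (hℓ : 0 < ℓ) :
    profileSurface x z ⊆ stackedSurface ℓ γ := by
  rintro p ⟨u, hx, hz⟩
  have hplane {j : ℕ} (hj : (j : ℕ∞) < ℓ) (hp : p ∈ cutPlane j (removedSides ℓ j)) :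
      p ∈ stackedSurface ℓ γ := .inl (Set.mem_biUnion (Set.mem_ofPred.2 hj) hp)
  rcases paramSet_cases hℓ u with hu | ⟨j, hj, rfl⟩ | ⟨j, hj, hu⟩ | ⟨j, hj, hu⟩
  · refine hplane (j := 0) hℓ (mem_cutPlane_removedSides_iff.2 ⟨?_, by simp, fun _ => ?_⟩)
    · simpa using hz.trans (h.left_height u hu.le)
    · simpa [hx] using (h.left_tail.pos hu).le
  · refine hplane hj (mem_cutPlane_removedSides_iff.2 ⟨hz.trans (h.right_joint hγ hj), ?_, ?_⟩)
    all_goals simp [hx, h.left_joint hγ hj]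
  · have hmem : u ∈ paramSet ℓ := Icc_subset_paramSet hj (Set.Ioo_subset_Icc_self hu)
    have hxu := (h.eventuallyEq_left u hmem).self_of_nhds
    refine .inr ⟨γ u, ⟨u, hmem, rfl⟩, (exists_eq_linearFlow_iff ?_ (hγ.planar u hmem)).2 ?_⟩
    · exact right_ne_zero_of_mul (hγ.side j hj u hu).ne'
    · exact ⟨hx.trans hxu, hz.trans (h.eqOn_right u hmem)⟩
  · refine hplane (hj ▸ by exact_mod_cast j.lt_succ_self) (mem_cutPlane_removedSides_iff.2
      ⟨hz.trans (h.right_height j hj u hu.le), fun _ => ?_, fun hlt => absurd hj hlt.ne⟩)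
    have hpos := h.left_pos_of_eq hj hu
    rw [pow_succ, ← hx] at hpos
    linarith

end IsContinuation

theorem IsSnake.exists_isLinearizingEmbedding {ℓ : ℕ∞} {γ : ℝ → Eucl (Fin 3)} (hγ : IsSnake ℓ γ)
    (hℓ : 2 ≤ ℓ) : ∃ (Φ : Flow ℝ (Eucl (Fin 2))) (f : Eucl (Fin 2) → Eucl (Fin 3)),
      IsSmoothFlow Φ ∧ HasIsolatedEquilibria Φ ℓ ∧
      IsLinearizingEmbedding Φ hyperbolicMatrix f ∧ Set.range f = stackedSurface ℓ γ := by
  obtain ⟨x, z, h⟩ := hγ.exists_isContinuation hℓ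
  have hpos : 0 < ℓ := two_pos.trans_le hℓ
  obtain ⟨Φ, f, hΦ, heq, hf, hrange⟩ := (h.isProfile hγ hℓ).exists_isLinearizingEmbedding
  rw [h.encard_setOf_left_eq_zero hγ hpos] at heq
  exact ⟨Φ, f, hΦ, heq, hf, hrange.trans
    ((h.profileSurface_subset hγ hpos).antisymm (h.stackedSurface_subset hγ))⟩

theorem stackedSurface_two (γ : ℝ → Eucl (Fin 3)) :
    stackedSurface 2 γ =
      cutPlane 1 {-1} ∪ orbitsThrough (γ '' Set.Icc 0 1) ∪ cutPlane 0 {-1} := by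
  have hlt (j : ℕ) : (j : ℕ∞) < 2 ↔ j = 0 ∨ j = 1 := by
    rw [← Nat.le_one_iff_eq_zero_or_eq_one, ← Nat.lt_succ_iff]
    exact Nat.cast_lt (α := ℕ∞) (n := 2)
  have hplane₀ : removedSides 2 0 = {-1} := by
    ext σ
    simp [removedSides]
  have hplane₁ : removedSides 2 1 = {-1} := by
    ext σ
    simp [removedSides]
  have hparam : paramSet 2 = Set.Icc 0 1 := by
    ext s
    simp only [paramSet, Set.mem_ofPred_eq, hlt, or_and_right, exists_or, exists_eq_left,
      Nat.cast_zero, Nat.cast_one, Set.mem_Icc]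
    exact and_congr_right fun _ => or_iff_right_of_imp fun h => h.trans zero_le_one
  have hset : {j : ℕ | (j : ℕ∞) < 2} = {0, 1} := Set.ext hlt
  rw [stackedSurface, hset, Set.biUnion_pair, hplane₀, hplane₁, arc, hparam, Nat.cast_zero,
    Nat.cast_one, Set.union_comm (cutPlane 0 _), Set.union_right_comm]

/-! ### Existence of snakes -/

/-- A smooth function of period `1` that is positive off the integers and flat at the integers. -/
noncomputable def flatPulse (s : ℝ) : ℝ :=
  expNegInvGlue (Real.sin (Real.pi * s) ^ 2)

theorem flatPulse_periodic : Function.Periodic flatPulse 1 := fun s => by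
  simp only [flatPulse, mul_add, mul_one, Real.sin_add_pi, neg_sq]

theorem flatPulse_pos_iff {s : ℝ} : 0 < flatPulse s ↔ Real.sin (Real.pi * s) ≠ 0 := by
  refine ⟨?_, fun hs => expNegInvGlue.pos_of_pos (by positivity)⟩
  contrapose!
  intro hs
  simp [flatPulse, hs]

theorem sin_pi_mul_pos {j : ℕ} {s : ℝ} (hs : s ∈ Set.Ioo (j : ℝ) (j + 1)) :
    0 < (-1) ^ j * Real.sin (Real.pi * s) := by
  rw [← Real.sin_sub_nat_mul_pi]
  apply Real.sin_pos_of_pos_of_lt_pi <;> nlinarith [Real.pi_pos, hs.1, hs.2]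

theorem isFlatAt_flatPulse (j : ℕ) : IsFlatAt flatPulse j :=
  have hglue : IsFlatAt expNegInvGlue 0 :=
    .of_eqOn_Iic expNegInvGlue.contDiff fun _ => expNegInvGlue.zero_of_nonpos
  IsFlatAt.comp (g := fun s => Real.sin (Real.pi * s) ^ 2)
    (by simpa [mul_comm Real.pi] using hglue) (by fun_prop)

theorem flatPulse_natCast (j : ℕ) : flatPulse j = 0 := by
  simp [flatPulse, mul_comm Real.pi]

/-- A smooth function with value `j` at every natural number `j` that is flat there and strictly
increasing in between. -/
noncomputable def staircase (s : ℝ) : ℝ :=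
  (∫ u in 0..s, flatPulse u) / ∫ u in 0..1, flatPulse u

theorem continuous_flatPulse : Continuous flatPulse :=
  (isFlatAt_flatPulse 0).contDiff.continuous

theorem integral_flatPulse_pos : 0 < ∫ u in 0..1, flatPulse u := by
  refine intervalIntegral.intervalIntegral_pos_of_pos_on
    (continuous_flatPulse.intervalIntegrable 0 1) (fun s hs => flatPulse_pos_iff.2 ?_) one_pos
  exact right_ne_zero_of_mul (sin_pi_mul_pos (j := 0) (by simpa using hs)).ne'

theorem hasDerivAt_staircase (s : ℝ) :
    HasDerivAt staircase (flatPulse s / ∫ u in 0..1, flatPulse u) s :=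
  (continuous_flatPulse.integral_hasStrictDerivAt 0 s).hasDerivAt.div_const _

theorem isFlatAt_staircase (j : ℕ) : IsFlatAt staircase j :=
  ((isFlatAt_flatPulse j).div_const _).of_hasDerivAt
    (by rw [flatPulse_natCast, zero_div]) hasDerivAt_staircase

theorem staircase_natCast (j : ℕ) : staircase j = j := by
  have hint : ∫ u in 0..(j : ℝ), flatPulse u = j * ∫ u in 0..1, flatPulse u := by
    simpa using flatPulse_periodic.intervalIntegral_add_zsmul_eq j 0
      fun _ _ => continuous_flatPulse.intervalIntegrable _ _
  rw [staircase, hint, mul_div_cancel_right₀ _ integral_flatPulse_pos.ne']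

theorem deriv_staircase_pos_iff {s : ℝ} :
    0 < deriv staircase s ↔ Real.sin (Real.pi * s) ≠ 0 := by
  rw [(hasDerivAt_staircase s).deriv, div_pos_iff_of_pos_right integral_flatPulse_pos,
    flatPulse_pos_iff]

theorem exists_isSnake (ℓ : ℕ∞) : ∃ γ : ℝ → Eucl (Fin 3), IsSnake ℓ γ := by
  let γ : ℝ → Eucl (Fin 3) := fun s => !₂[-Real.sin (Real.pi * s), 0, staircase s]
  have hγ : ContDiff ℝ ∞ γ := contDiff_euclidean.2 fun i => by
    fin_cases i
    exacts [by simpa [γ] using by fun_prop, contDiff_const, (isFlatAt_staircase 0).contDiff]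
  refine ⟨γ, hγ, fun s _ hderiv => ?_, fun _ _ => rfl, fun j _ => ⟨?_, staircase_natCast j⟩,
    fun j _ => (isFlatAt_staircase j).iteratedDeriv_eq_zero, fun j _ s hs => ?_,
    fun j _ s hs => deriv_staircase_pos_iff.2 (right_ne_zero_of_mul (sin_pi_mul_pos hs).ne')⟩
  · have hcoord := hasDerivAt_coord (hγ.differentiable (by simp) s)
    simp only [hderiv, PiLp.zero_apply] at hcoord
    have hsin : Real.sin (Real.pi * s) = 0 := by
      by_contra hne
      exact (deriv_staircase_pos_iff.2 hne).ne' (hcoord 2).deriv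
    have hcos : Real.cos (Real.pi * s) = 0 := by
      have hx : HasDerivAt (fun s => γ s 0) (-(Real.cos (Real.pi * s) * (Real.pi * 1))) s :=
        ((hasDerivAt_id s).const_mul Real.pi).sin.neg
      simpa [Real.pi_ne_zero] using hx.unique (hcoord 0)
    simpa [hsin, hcos] using Real.sin_sq_add_cos_sq (Real.pi * s)
  · simp [γ, mul_comm Real.pi]
  · simpa [γ, pow_succ] using sin_pi_mul_pos hs

/-! ### All numbers of equilibria in all dimensions -/

theorem isProfile_one_id : IsProfile (fun _ => 1) fun s => s where
  contDiff_left := contDiff_const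
  contDiff_right := contDiff_id
  injective _ _ _ h := h
  regular s _ := by simp
  eq_intCast s hs := absurd hs one_ne_zero
  flat s hs := absurd hs one_ne_zero
  isBounded M := (Metric.isBounded_closedBall (x := (0 : ℝ)) (r := M)).subset fun s hs => by
    simpa using hs.2

theorem isProfile_id_zero : IsProfile (fun s => s) fun _ => 0 where
  contDiff_left := contDiff_id
  contDiff_right := contDiff_const
  injective _ _ h _ := h
  regular s hs := by simp at hs
  eq_intCast s hs := ⟨0, by simpa using hs⟩
  flat s _ := isFlatAt_const 0 s
  isBounded M := (Metric.isBounded_closedBall (x := (0 : ℝ)) (r := M)).subset fun s hs => by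
    simpa using hs.1

theorem exists_planar_isLinearizingEmbedding (ℓ : ℕ∞) :
    ∃ (Φ : Flow ℝ (Eucl (Fin 2))) (f : Eucl (Fin 2) → Eucl (Fin 3)),
      IsSmoothFlow Φ ∧ HasIsolatedEquilibria Φ ℓ ∧ IsLinearizingEmbedding Φ hyperbolicMatrix f := by
  rcases lt_or_ge ℓ 2 with hℓ | hℓ
  · obtain ⟨x, z, hxz, rfl⟩ : ∃ x z, IsProfile x z ∧ {s | x s = 0}.encard = ℓ := by
      lift ℓ to ℕ using hℓ.ne_top
      have hℓ : ℓ < 2 := by exact_mod_cast hℓ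
      interval_cases ℓ
      · exact ⟨_, _, isProfile_one_id, by simp⟩
      · exact ⟨_, _, isProfile_id_zero, by simp⟩
    obtain ⟨Φ, f, hΦ, heq, hf, -⟩ := hxz.exists_isLinearizingEmbedding
    exact ⟨Φ, f, hΦ, heq, hf⟩
  · obtain ⟨γ, hγ⟩ := exists_isSnake ℓ
    obtain ⟨Φ, f, hΦ, heq, hf, -⟩ := hγ.exists_isLinearizingEmbedding hℓ
    exact ⟨Φ, f, hΦ, heq, hf⟩

theorem exists_admitsLinearizingEmbedding {ι : Type} [Fintype ι] (hι : 2 ≤ Fintype.card ι)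
    (ℓ : ℕ∞) : ∃ Φ : Flow ℝ (Eucl ι),
      IsSmoothFlow Φ ∧ HasIsolatedEquilibria Φ ℓ ∧ AdmitsLinearizingEmbedding Φ := by
  obtain ⟨Φ, f, hΦ, heq, hf⟩ := exists_planar_isLinearizingEmbedding ℓ
  obtain ⟨m, hm⟩ := Nat.exists_eq_add_of_le hι
  let e : Fin 2 ⊕ Fin m ≃ ι := Fintype.equivOfCardEq (by simp [hm])
  let L := (LinearIsometryEquiv.piLpCongrLeft 2 ℝ ℝ e).toContinuousLinearEquiv
  exact ⟨conjFlow L (expandFlow m Φ), (hΦ.expandFlow m).conjFlow L, (heq.expandFlow m).conjFlow L,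
    (hf.expandMap m).admitsLinearizingEmbedding_conjFlow L⟩

theorem mainTheorem3_general :
    (∀ (ι : Type) [Fintype ι], 2 ≤ Fintype.card ι → ∀ ℓ : ℕ∞, ∃ Φ : Flow ℝ (Eucl ι),
      IsSmoothFlow Φ ∧ HasIsolatedEquilibria Φ ℓ ∧ AdmitsLinearizingEmbedding Φ) ∧
    (∀ γ : ℝ → Eucl (Fin 3),
      stackedSurface 2 γ =
        cutPlane 1 {-1} ∪ orbitsThrough (γ '' Set.Icc 0 1) ∪ cutPlane 0 {-1}) ∧
    (∀ ℓ : ℕ∞, ∃ γ : ℝ → Eucl (Fin 3), IsSnake ℓ γ) ∧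
    (∀ (ℓ : ℕ∞) (γ : ℝ → Eucl (Fin 3)), 2 ≤ ℓ → IsSnake ℓ γ →
      (∀ t : ℝ, linearFlow hyperbolicMatrix t '' stackedSurface ℓ γ = stackedSurface ℓ γ) ∧
      ∃ (Φ : Flow ℝ (Eucl (Fin 2))) (f : Eucl (Fin 2) → Eucl (Fin 3)),
        IsSmoothFlow Φ ∧ HasIsolatedEquilibria Φ ℓ ∧
        IsLinearizingEmbedding Φ hyperbolicMatrix f ∧ Set.range f = stackedSurface ℓ γ) ∧
    (∀ (ι κ : Type) [Fintype ι] [Fintype κ] [DecidableEq κ] (ℓ : ℕ∞) (Φ : Flow ℝ (Eucl ι))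
      (A : Matrix κ κ ℝ) (f : Eucl ι → Eucl κ),
      IsSmoothFlow Φ → HasIsolatedEquilibria Φ ℓ → IsLinearizingEmbedding Φ A f →
      ∀ m : ℕ,
        IsSmoothFlow (expandFlow m Φ) ∧ HasIsolatedEquilibria (expandFlow m Φ) ℓ ∧
        IsLinearizingEmbedding (expandFlow m Φ) (Matrix.fromBlocks A 0 0 1) (expandMap m f)) := by
  refine ⟨fun ι _ hι => exists_admitsLinearizingEmbedding hι, stackedSurface_two, exists_isSnake,
    fun ℓ γ hℓ hγ => ?_, fun ι κ _ _ _ ℓ Φ A f hΦ heq hf m =>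
      ⟨hΦ.expandFlow m, heq.expandFlow m, hf.expandMap m⟩⟩
  obtain ⟨Φ, f, hΦ, heq, hf, hrange⟩ := hγ.exists_isLinearizingEmbedding hℓ
  exact ⟨hrange ▸ hf.linearFlow_image_range, Φ, f, hΦ, heq, hf, hrange⟩

theorem mainTheorem3 :
    -- On every `ℝ^k`, `k ≥ 2`, any countable number of isolated equilibria is possible.
    (∀ k : ℕ, 2 ≤ k → ∀ ℓ : ℕ∞, ∃ Φ : Flow ℝ (Eucl (Fin k)),
      IsSmoothFlow Φ ∧ HasIsolatedEquilibria Φ ℓ ∧ AdmitsLinearizingEmbedding Φ) ∧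
    -- For `ℓ = 2` the surface is `A₁ ∪ B ∪ A₀`.
    (∀ γ : ℝ → Eucl (Fin 3),
      stackedSurface 2 γ =
        cutPlane 1 {-1} ∪ orbitsThrough (γ '' Set.Icc 0 1) ∪ cutPlane 0 {-1}) ∧
    -- Suitable curves exist for every countable `ℓ ≥ 2`, and for each of them the surface is
    -- invariant and is the image of a linearizing embedding of a planar system with exactly `ℓ`
    -- isolated equilibria.
    (∀ ℓ : ℕ∞, 2 ≤ ℓ →
      (∃ γ : ℝ → Eucl (Fin 3), IsSnake ℓ γ) ∧
      ∀ γ : ℝ → Eucl (Fin 3), IsSnake ℓ γ →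
        (∀ t : ℝ, linearFlow hyperbolicMatrix t '' stackedSurface ℓ γ = stackedSurface ℓ γ) ∧
        ∃ (Φ : Flow ℝ (Eucl (Fin 2))) (f : Eucl (Fin 2) → Eucl (Fin 3)),
          IsSmoothFlow Φ ∧ HasIsolatedEquilibria Φ ℓ ∧
          IsLinearizingEmbedding Φ hyperbolicMatrix f ∧ Set.range f = stackedSurface ℓ γ) ∧
    -- Adding the coordinates `w' = w` extends any such planar system to higher dimensions.
    (∀ (ℓ : ℕ∞) (Φ : Flow ℝ (Eucl (Fin 2))) (n : ℕ) (A : Matrix (Fin n) (Fin n) ℝ)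
      (f : Eucl (Fin 2) → Eucl (Fin n)),
      IsSmoothFlow Φ → HasIsolatedEquilibria Φ ℓ → IsLinearizingEmbedding Φ A f →
      ∀ m : ℕ,
        IsSmoothFlow (expandFlow m Φ) ∧ HasIsolatedEquilibria (expandFlow m Φ) ℓ ∧
        IsLinearizingEmbedding (expandFlow m Φ) (Matrix.fromBlocks A 0 0 1) (expandMap m f)) := by
  obtain ⟨hflow, htwo, hsnake, hsurface, hexpand⟩ := mainTheorem3_general
  exact ⟨fun k hk => hflow (Fin k) (by simpa), htwo,
    fun ℓ hℓ => ⟨hsnake ℓ, fun γ => hsurface ℓ γ hℓ⟩, fun ℓ Φ n => hexpand (Fin 2) (Fin n) ℓ Φ⟩
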